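/- Let $n\ge 1$, let $\Omega\subset\mathbb R^n$ be a bounded open set and let $\lambda>0$. There is a constant $C$ depending only on $n$, $\Omega$ and $\lambda$ such that the following holds. Let $a=a(x)$ be a time-independent symmetric matrix field with entries in $L^\infty(\Omega)$ such that ${}^t\xi a(x)\xi\ge\lambda|\xi|^2$ for almost every $x\in\Omega$ and all $\xi\in\mathbb R^n$, and write $a[v,w]:=\int_\Omega {}^t\nabla v\,a\,\nabla w\,dx$. Let $F=(F_1,\dots,F_n)$ be the associated harmonic coordinates, i.e. the weak solution of $$\operatorname{div}(a\nabla F)=0\ \text{ in }\Omega,\qquad F(x)=x\ \text{ on }\partial\Omega .$$ Let $X_h$ be a finite dimensional subspace of $H^1_0(\Omega)$ consisting of uniformly Lipschitz continuous functions on $\Omega$, extended by $0$ outside $\Omega$, and let $V_h:=\{\varphi\circ F:\varphi\in X_h\}\cap H^1_0(\Omega)$ (if $\Omega$ is convex and of class $C^2$, every $\varphi\circ F$ lies in $H^1_0(\Omega)$). Let $T>0$, and let $g\in L^2(0,T;L^2(\Omega))$ with $\partial_t g\in L^2(0,T;H^{-1}(\Omega))$ and $g(\cdot,0)\in L^2(\Omega)$.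 Let $u_h:[0,T]\to V_h$ be the solution of the semi-discrete problem: $u_h$ is absolutely continuous, $u_h(0)=0$, and for almost every $t\in(0,T)$, $$(\psi,\partial_t u_h)_{L^2(\Omega)}+a[\psi,u_h]=(\psi,g)_{L^2(\Omega)}\qquad\text{for all }\psi\in V_h .$$ Let $M\ge1$ be an integer, $\Delta t:=T/M$, $t_m:=m\,\Delta t$, and let $v:[0,T]\to V_h$ be the solution of the implicit scheme: $v$ is constant on each interval $(t_m,t_{m+1}]$, $v(0)=0$, and for all $m\in\{0,\dots,M-1\}$ and $\psi\in V_h$, $$(\psi,v(t_{m+1}))_{L^2(\Omega)}=(\psi,v(t_m))_{L^2(\Omega)}+\int_{t_m}^{t_{m+1}}\Big(-a[\psi,v(t_{m+1})]+(\psi,g(t))_{L^2(\Omega)}\Big)dt .$$ Then $$\|(u_h-v)(T)\|_{L^2(\Omega)}+\|u_h-v\|_{L^2(0,T;H^1_0(\Omega))}\le C\,|\Delta t|\,\Big(\|\partial_t g\|_{L^2(0,T;H^{-1}(\Omega))}+\|g(\cdot,0)\|_{L^2(\Omega)}\Big).$$ Here $H^1_0(\Omega)$ carries the norm $(\|w\|_{L^2(\Omega)}^2+\|\nabla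 w\|_{L^2(\Omega)}^2)^{1/2}$ and $H^{-1}(\Omega)$ is its dual with the dual norm. -/

import Mathlib

open MeasureTheory Set
open scoped ENNReal ContDiff

namespace ParabolicHomogenization

noncomputable section

/-- Euclidean space `ℝⁿ`. -/
abbrev Space (n : ℕ) : Type := EuclideanSpace ℝ (Fin n)

/-- Lebesgue measure on `Ω`. -/
abbrev vol {n : ℕ} (Ω : Set (Space n)) : Measure (Space n) := volume.restrict Ω

/-- The space `L²(Ω)` of real functions. -/
abbrev L2 {n : ℕ} (Ω : Set (Space n)) : Type := Lp ℝ 2 (vol Ω)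

/-- The space `L²(Ω; ℝⁿ)` of vector fields. -/
abbrev L2Vec {n : ℕ} (Ω : Set (Space n)) : Type := Lp (Space n) 2 (vol Ω)

/-- The Hilbert space `L²(Ω) × L²(Ω; ℝⁿ)` with norm `(‖u‖² + ‖G‖²)^(1/2)`; a Sobolev function `u` is
represented in it by the pair `(u, ∇u)`, so that the norm is the `H¹` norm. -/
abbrev L2Pair {n : ℕ} (Ω : Set (Space n)) : Type := WithLp 2 (L2 Ω × L2Vec Ω)

/-- `φ ∈ C_c^∞(Ω)`. -/
structure IsTestFunction {n : ℕ} (Ω : Set (Space n)) (φ : Space n → ℝ) : Prop where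
  smooth : ContDiff ℝ ∞ φ
  compact : HasCompactSupport φ
  support : tsupport φ ⊆ Ω

/-- The linear space of the pairs `(φ, ∇φ)` with `φ ∈ C_c^∞(Ω)`. -/
def testPairs {n : ℕ} (Ω : Set (Space n)) : Submodule ℝ (L2Pair Ω) where
  carrier := {p | ∃ φ : Space n → ℝ, IsTestFunction Ω φ ∧
    (p.fst : Space n → ℝ) =ᵐ[vol Ω] φ ∧ (p.snd : Space n → Space n) =ᵐ[vol Ω] gradient φ}
  zero_mem' := by
    refine ⟨0, ⟨contDiff_const, HasCompactSupport.zero, by simp [tsupport]⟩, ?_, ?_⟩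
    · exact Lp.coeFn_zero _ _ _
    · have h : gradient (0 : Space n → ℝ) = 0 := by
        ext1 x
        exact gradient_const x (0 : ℝ)
      rw [h]
      exact Lp.coeFn_zero _ _ _
  add_mem' := by
    rintro p q ⟨φ, hφ, h1, h2⟩ ⟨ψ, hψ, h3, h4⟩
    refine ⟨φ + ψ, ⟨hφ.smooth.add hψ.smooth, hφ.compact.add hψ.compact,
      (tsupport_add φ ψ).trans (union_subset hφ.support hψ.support)⟩, ?_, ?_⟩
    · exact (Lp.coeFn_add p.fst q.fst).trans (h1.add h3)
    · have h : gradient (φ + ψ) = gradient φ + gradient ψ := by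
        ext1 x
        have hx : DifferentiableAt ℝ φ x := hφ.smooth.differentiable (by simp) x
        have hy : DifferentiableAt ℝ ψ x := hψ.smooth.differentiable (by simp) x
        simp [gradient, fderiv_add hx hy]
      rw [h]
      exact (Lp.coeFn_add p.snd q.snd).trans (h2.add h4)
  smul_mem' := by
    rintro c p ⟨φ, hφ, h1, h2⟩
    refine ⟨c • φ, ⟨hφ.smooth.const_smul c, hφ.compact.smul_left (f := fun _ => c),
      (closure_mono (Function.support_const_smul_subset c φ)).trans hφ.support⟩, ?_, ?_⟩
    · exact (Lp.coeFn_smul c p.fst).trans (h1.const_smul c)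
    · have h : gradient (c • φ) = c • gradient φ := by
        ext1 x
        have hx : DifferentiableAt ℝ φ x := hφ.smooth.differentiable (by simp) x
        simp [gradient, fderiv_const_smul hx]
      rw [h]
      exact (Lp.coeFn_smul c p.snd).trans (h2.const_smul c)

/-- The Sobolev space `H¹₀(Ω)`: the closure of `C_c^∞(Ω)` for the norm
`(‖u‖²_{L²(Ω)} + ‖∇u‖²_{L²(Ω)})^(1/2)`, realized as the closure of the pairs `(φ, ∇φ)`. -/
abbrev H10 {n : ℕ} (Ω : Set (Space n)) : Submodule ℝ (L2Pair Ω) :=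
  (testPairs Ω).topologicalClosure

/-- The function underlying an element of `H¹₀(Ω)`. -/
def fn {n : ℕ} {Ω : Set (Space n)} (u : H10 Ω) : L2 Ω := (u : L2Pair Ω).fst

/-- The weak gradient of an element of `H¹₀(Ω)`. -/
def grad {n : ℕ} {Ω : Set (Space n)} (u : H10 Ω) : L2Vec Ω := (u : L2Pair Ω).snd

/-- `H⁻¹(Ω)`, the dual of `H¹₀(Ω)`, with the dual norm. -/
abbrev Hneg1 {n : ℕ} (Ω : Set (Space n)) : Type := StrongDual ℝ (H10 Ω)

/-- The embedding `L²(Ω) → H⁻¹(Ω)`: `f ↦ (ψ ↦ (f, ψ)_{L²(Ω)})`. -/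
def toHneg1 {n : ℕ} {Ω : Set (Space n)} (f : L2 Ω) : Hneg1 Ω :=
  (innerSL ℝ f).comp ((WithLp.fstL 2 ℝ (L2 Ω) (L2Vec Ω)).comp (H10 Ω).subtypeL)

/-- The coefficient field `x ↦ a(x)` of a time-independent medium: symmetric matrices with entries in
`L^∞(Ω)`, uniformly elliptic with lower bound `lam`. -/
structure IsEllipticMedium {n : ℕ} (Ω : Set (Space n))
    (a : Space n → Matrix (Fin n) (Fin n) ℝ) (lam : ℝ) : Prop where
  bounded : ∀ i j, MemLp (fun x => a x i j) ∞ (vol Ω)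
  symm : ∀ᵐ x ∂(vol Ω), (a x).IsSymm
  elliptic : ∀ᵐ x ∂(vol Ω), ∀ ξ : Space n,
    lam * ‖ξ‖ ^ 2 ≤ ∑ i, ∑ j, ξ i * a x i j * ξ j

/-- `∫_Ω ᵗG(x) a(x) H(x) dx` for two vector fields. -/
def energyForm {n : ℕ} (Ω : Set (Space n)) (a : Space n → Matrix (Fin n) (Fin n) ℝ)
    (G H : Space n → Space n) : ℝ :=
  ∫ x in Ω, ∑ i, ∑ j, G x i * a x i j * H x j

/-- The bilinear form `a[v, w] = ∫_Ω ᵗ∇v a ∇w dx` on `H¹₀(Ω)`. -/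
def dirichletForm {n : ℕ} {Ω : Set (Space n)} (a : Space n → Matrix (Fin n) (Fin n) ℝ)
    (v w : H10 Ω) : ℝ :=
  energyForm Ω a (grad v) (grad w)

/-- `F = (F₁, …, Fₙ)` are the harmonic coordinates of the medium `a`: each `F_k` is the weak solution
of `div (a ∇F_k) = 0` in `Ω`, `F_k(x) = x_k` on `∂Ω`. That is, `F_k = x_k + w_k` with
`w_k ∈ H¹₀(Ω)` and `∫_Ω ᵗ∇ψ a (e_k + ∇w_k) dx = 0` for all `ψ ∈ H¹₀(Ω)`. -/
def IsHarmonicCoordinates {n : ℕ} (Ω : Set (Space n))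
    (a : Space n → Matrix (Fin n) (Fin n) ℝ) (F : Space n → Space n) : Prop :=
  ∀ k : Fin n, ∃ w : H10 Ω,
    (∀ᵐ x ∂(vol Ω), F x k = x k + fn w x) ∧
    ∀ ψ : H10 Ω,
      energyForm Ω a (grad ψ) (fun x => EuclideanSpace.single k (1 : ℝ) + grad w x) = 0

/-- `X` is a finite dimensional subspace of `H¹₀(Ω) ∩ W^{1,∞}(Ω)`, where `W^{1,∞}(Ω)` is the space of
uniformly Lipschitz continuous functions on `Ω`. Its elements are extended by zero outside `Ω`. -/
structure IsElementSpace {n : ℕ} (Ω : Set (Space n)) (X : Submodule ℝ (Space n → ℝ)) : Prop where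
  finite : FiniteDimensional ℝ X
  memH10 : ∀ φ ∈ X, ∃ w : H10 Ω, (fn w : Space n → ℝ) =ᵐ[vol Ω] φ
  lipschitz : ∀ φ ∈ X, ∃ K, LipschitzOnWith K φ Ω
  zero_outside : ∀ φ ∈ X, ∀ x ∉ Ω, φ x = 0

/-- The space `V_h = {φ ∘ F : φ ∈ X_h}` of elements in harmonic coordinates, as a set of elements of
`H¹₀(Ω)`. -/
def elementsInCoordinates {n : ℕ} (Ω : Set (Space n)) (F : Space n → Space n)
    (X : Submodule ℝ (Space n → ℝ)) : Set (H10 Ω) :=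
  {w | ∃ φ ∈ X, (fn w : Space n → ℝ) =ᵐ[vol Ω] fun x => φ (F x)}

/-- `g ∈ L²(0,T; L²(Ω))` has the time derivative `∂ₜg = dg ∈ L²(0,T; H⁻¹(Ω))` and the initial value
`g(·,0) = g0 ∈ L²(Ω)`: `g(t) = g0 + ∫₀ᵗ dg(s) ds` in `H⁻¹(Ω)` for almost every `t`. -/
structure HasTimeDerivative {n : ℕ} {Ω : Set (Space n)} (T : ℝ) (g : ℝ → L2 Ω)
    (dg : ℝ → Hneg1 Ω) (g0 : L2 Ω) : Prop where
  memLp : MemLp g 2 (volume.restrict (Ioo 0 T))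
  memLp_deriv : MemLp dg 2 (volume.restrict (Ioo 0 T))
  eq_integral : ∀ᵐ t ∂(volume.restrict (Ioo 0 T)),
    toHneg1 (g t) = toHneg1 g0 + ∫ s in (0 : ℝ)..t, dg s

/-- `u` is the solution of the semi-discrete problem: `u(t) ∈ V` for all `t ∈ [0,T]`, `u(0) = 0`, `u` is
absolutely continuous with derivative `∂ₜu = du`, and for almost every `t ∈ (0,T)`,
`(ψ, ∂ₜu)_{L²(Ω)} + a[ψ, u] = (ψ, g)_{L²(Ω)}` for all `ψ ∈ V`. -/
def IsSemiDiscreteSolution {n : ℕ} {Ω : Set (Space n)}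
    (a : Space n → Matrix (Fin n) (Fin n) ℝ) (V : Set (H10 Ω)) (T : ℝ) (g : ℝ → L2 Ω)
    (u : ℝ → H10 Ω) : Prop :=
  (∀ t ∈ Icc 0 T, u t ∈ V) ∧
  ∃ du : ℝ → H10 Ω, IntervalIntegrable du volume 0 T ∧
    (∀ t ∈ Icc 0 T, u t = ∫ s in (0 : ℝ)..t, du s) ∧
    ∀ᵐ t ∂(volume.restrict (Ioo 0 T)), ∀ ψ ∈ V,
      inner ℝ (fn ψ) (fn (du t)) + dirichletForm a ψ (u t) = inner ℝ (fn ψ) (g t)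

/-- The nodes `t_m = m T / M` of the time discretization. -/
def node (T : ℝ) (M m : ℕ) : ℝ := m * (T / M)

/-- `v` is the solution of the implicit scheme with `M` time steps: `v(t) ∈ V` for all `t ∈ [0,T]`,
`v` is constant on each `(t_m, t_{m+1}]`, `v(0) = 0`, and for `0 ≤ m < M` and `ψ ∈ V`,
`(ψ, v(t_{m+1})) = (ψ, v(t_m)) + ∫_{t_m}^{t_{m+1}} (- a[ψ, v(t_{m+1})] + (ψ, g(t))) dt`. -/
structure IsImplicitSolution {n : ℕ} {Ω : Set (Space n)}
    (a : Space n → Matrix (Fin n) (Fin n) ℝ) (V : Set (H10 Ω)) (T : ℝ) (M : ℕ) (g : ℝ → L2 Ω)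
    (v : ℝ → H10 Ω) : Prop where
  mem : ∀ t ∈ Icc 0 T, v t ∈ V
  const : ∀ m < M, ∀ t ∈ Ioc (node T M m) (node T M (m + 1)), v t = v (node T M (m + 1))
  initial : v 0 = 0
  step : ∀ m < M, ∀ ψ ∈ V,
    inner ℝ (fn ψ) (fn (v (node T M (m + 1)))) = inner ℝ (fn ψ) (fn (v (node T M m))) +
      ∫ t in (node T M m)..(node T M (m + 1)),
        (-dirichletForm a ψ (v (node T M (m + 1))) + inner ℝ (fn ψ) (g t))

/-- The norm of `L²(0,T; E)`. -/
def normL2Time {E : Type*} [NormedAddCommGroup E] (T : ℝ) (w : ℝ → E) : ℝ :=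
  Real.sqrt (∫ t in (0 : ℝ)..T, ‖w t‖ ^ 2)

end

end ParabolicHomogenization

/-!
The estimate is a statement about a bounded, symmetric, coercive bilinear form `B` on a Hilbert space
`E`, a continuous linear map `J : E → H` and a linear subspace `V` of test functions. Here
`E = H¹₀(Ω)`, `H = L²(Ω)`, `J` is the embedding, `B = a[·,·]` and `V = V_h`. The only constant that
enters is the coercivity constant `c` of `B`. It comes from ellipticity and the Poincaré inequality
(`poincare_inequality`), hence depends on `Ω` and `λ` alone and not on an upper bound of `a`.

The heart of the matter is the regularity bound
`∫₀ᵀ a[∂ₜu, ∂ₜu] ≤ K := 4 ‖g(0)‖² + 3 c⁻¹ ∫₀ᵀ ‖∂ₜg‖²` for the semi-discrete solution. Formally it is the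
energy inequality for the equation differentiated in time. Since `∂ₜu` is only known to be an
integrable function with values in `E`, the equation is not differentiated: the energy inequality is
applied to the increments `u(t + h) - u(t)`, which lie in `V`
(`IsEvolution.integral_form_increment_le`); the initial increment `u(h)` is of order `h` by the same
inequality on `(0, h)` (`IsEvolution.norm_sq_le`). Dividing by `h²` and letting `h → 0`, Lebesgue's
differentiation theorem and Fatou's lemma give the bound (`IsEvolution.integral_form_deriv_le`).

With `k = T/M` and `e_m = u(t_m) - v(t_m)`, subtracting the scheme from the equation integrated over
`(t_m, t_{m+1})` and testing with `e_{m+1}` gives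
`‖e_{m+1}‖² + k a[e_{m+1}, e_{m+1}] ≤ ‖e_m‖² + k² ∫ a[∂ₜu, ∂ₜu]` with the integral over the same interval
(`IsEvolution.error_step_le`). The sum over `m` is at most `k² K`; replacing `u(t_{m+1})` by `u(t)`
costs another multiple of `k² K` (`IsEvolution.integral_error_le`).
-/

namespace ParabolicHomogenization

open Filter Topology

/-! ### Vector-valued absolutely continuous functions of time -/

section Time

theorem absolutelyContinuousOnInterval_of_dist_le {X Y : Type*} [PseudoMetricSpace X]
    [PseudoMetricSpace Y] {f : ℝ → X} {g : ℝ → Y} {a b K : ℝ}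
    (hg : AbsolutelyContinuousOnInterval g a b)
    (h : ∀ x ∈ uIcc a b, ∀ y ∈ uIcc a b, dist (f x) (f y) ≤ K * dist (g x) (g y)) :
    AbsolutelyContinuousOnInterval f a b := by
  refine squeeze_zero' (Eventually.of_forall fun t => Finset.sum_nonneg fun i _ => dist_nonneg)
    ?_ (by simpa using Tendsto.const_mul K hg)
  filter_upwards [mem_inf_of_right (mem_principal_self _)] with e he
  rw [Finset.mul_sum]
  exact Finset.sum_le_sum fun i hi => h _ (he.1 i hi).1 _ (he.1 i hi).2

variable {E : Type*} [NormedAddCommGroup E]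

theorem intervalIntegrable_clm_comp [NormedSpace ℝ E] {F : Type*} [NormedAddCommGroup F]
    [NormedSpace ℝ F] (L : E →L[ℝ] F) {φ : ℝ → E} {s t : ℝ}
    (hφ : IntervalIntegrable φ volume s t) : IntervalIntegrable (fun r => L (φ r)) volume s t :=
  ⟨L.integrable_comp hφ.1, L.integrable_comp hφ.2⟩

theorem continuousOn_of_eq_add_integral [NormedSpace ℝ E] {z dz : ℝ → E} {τ : ℝ}
    (hdz : IntervalIntegrable dz volume 0 τ)
    (hz : ∀ t ∈ Icc 0 τ, z t = z 0 + ∫ s in (0 : ℝ)..t, dz s) : ContinuousOn z (Icc 0 τ) := by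
  rcases lt_or_ge τ 0 with h | hτ
  · simp [Icc_eq_empty (not_le.2 h)]
  have h := intervalIntegral.continuousOn_primitive_interval (μ := volume) (a := 0) (b := τ)
    (f := dz)
    (by rwa [uIcc_of_le hτ, integrableOn_Icc_iff_integrableOn_Ioc,
      ← intervalIntegrable_iff_integrableOn_Ioc_of_le hτ])
  rw [uIcc_of_le hτ] at h
  exact (continuousOn_const.add h).congr hz

theorem ae_hasDerivAt_of_eq_add_integral [NormedSpace ℝ E] [CompleteSpace E] {z dz : ℝ → E}
    {τ : ℝ} (hdz : IntervalIntegrable dz volume 0 τ)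
    (hz : ∀ t ∈ Icc 0 τ, z t = z 0 + ∫ s in (0 : ℝ)..t, dz s) :
    ∀ᵐ t, t ∈ Ioo 0 τ → HasDerivAt z (dz t) t := by
  filter_upwards [hdz.ae_hasDerivAt_integral] with t ht htm
  have hτ : 0 ≤ τ := htm.1.le.trans htm.2.le
  rw [uIcc_of_le hτ] at ht
  refine ((ht (Ioo_subset_Icc_self htm) 0 ⟨le_rfl, hτ⟩).const_add (z 0)).congr_of_eventuallyEq ?_
  filter_upwards [Icc_mem_nhds htm.1 htm.2] with s hs using hz s hs

theorem sub_eq_integral_of_eq_add_integral [NormedSpace ℝ E] {z dz : ℝ → E} {τ : ℝ}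
    (hdz : IntervalIntegrable dz volume 0 τ)
    (hz : ∀ t ∈ Icc 0 τ, z t = z 0 + ∫ s in (0 : ℝ)..t, dz s) {x y : ℝ}
    (hx : x ∈ Icc 0 τ) (hy : y ∈ Icc 0 τ) : z y - z x = ∫ s in x..y, dz s := by
  have h0 : ∀ {w}, w ∈ Icc 0 τ → IntervalIntegrable dz volume 0 w := fun {w} hw =>
    hdz.mono_set (by rw [uIcc_of_le hw.1, uIcc_of_le (hw.1.trans hw.2)]
                     exact Icc_subset_Icc_right hw.2)
  rw [hz y hy, hz x hx, add_sub_add_left_eq_sub,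
    intervalIntegral.integral_interval_sub_left (h0 hy) (h0 hx)]

/-- The energy identity `‖z(τ)‖² - ‖z(0)‖² = ∫ 2 (z, z')` for a primitive `z` of an integrable
function. It is the fundamental theorem of calculus for the real function `‖z‖²`, whose increments are
controlled by those of the primitive of `‖z'‖`, so that it is absolutely continuous. -/
theorem integral_inner_deriv [InnerProductSpace ℝ E] [CompleteSpace E] {z dz : ℝ → E} {τ : ℝ}
    (hτ : 0 ≤ τ) (hdz : IntervalIntegrable dz volume 0 τ)
    (hz : ∀ t ∈ Icc 0 τ, z t = z 0 + ∫ s in (0 : ℝ)..t, dz s) :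
    IntervalIntegrable (fun t => 2 * inner ℝ (z t) (dz t)) volume 0 τ ∧
      ∫ t in (0 : ℝ)..τ, 2 * inner ℝ (z t) (dz t) = ‖z τ‖ ^ 2 - ‖z 0‖ ^ 2 := by
  obtain ⟨R, hR⟩ := isCompact_Icc.exists_bound_of_continuousOn
    (continuousOn_of_eq_add_integral hdz hz)
  have hac : AbsolutelyContinuousOnInterval (fun t => ‖z t‖ ^ 2) 0 τ := by
    refine absolutelyContinuousOnInterval_of_dist_le (K := 2 * R)
      (hdz.norm.absolutelyContinuousOnInterval_intervalIntegral (c := 0) left_mem_uIcc) ?_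
    intro x hx y hy
    rw [uIcc_of_le hτ] at hx hy
    have hn : ‖z x - z y‖ ≤ dist (∫ s in (0 : ℝ)..x, ‖dz s‖) (∫ s in (0 : ℝ)..y, ‖dz s‖) := by
      have h0 : ∀ {w}, w ∈ Icc 0 τ → IntervalIntegrable (fun s => ‖dz s‖) volume 0 w :=
        fun {w} hw => hdz.norm.mono_set (by
          rw [uIcc_of_le hw.1, uIcc_of_le hτ]; exact Icc_subset_Icc_right hw.2)
      rw [sub_eq_integral_of_eq_add_integral hdz hz hy hx, Real.dist_eq,
        intervalIntegral.integral_interval_sub_left (h0 hx) (h0 hy)]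
      exact intervalIntegral.norm_integral_le_abs_integral_norm
    have h1 : dist (‖z x‖ ^ 2) (‖z y‖ ^ 2) ≤ (‖z x‖ + ‖z y‖) * ‖z x - z y‖ := by
      rw [Real.dist_eq, sq_sub_sq, abs_mul, abs_of_nonneg (by positivity)]
      gcongr
      exact abs_norm_sub_norm_le _ _
    have h2 : ‖z x‖ + ‖z y‖ ≤ 2 * R := by linarith [hR x hx, hR y hy]
    exact h1.trans (mul_le_mul h2 hn (norm_nonneg _) ((by positivity : (0:ℝ) ≤ _).trans h2))
  have hd : ∀ᵐ t, t ∈ uIoc 0 τ → deriv (fun t => ‖z t‖ ^ 2) t = 2 * inner ℝ (z t) (dz t) := by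
    filter_upwards [ae_hasDerivAt_of_eq_add_integral hdz hz,
      (by simp [ae_iff, measure_singleton] : ∀ᵐ x : ℝ, x ≠ τ)] with t ht hne hm
    rw [uIoc_of_le hτ] at hm
    exact (ht ⟨hm.1, lt_of_le_of_ne hm.2 hne⟩).norm_sq.deriv
  refine ⟨hac.intervalIntegrable_deriv.congr_ae ?_, ?_⟩
  · exact (ae_restrict_iff' measurableSet_uIoc).2 hd
  · rw [← hac.integral_deriv_eq_sub]
    exact (intervalIntegral.integral_congr_ae hd).symm

end Time

section Form

variable {E : Type*} [NormedAddCommGroup E] [NormedSpace ℝ E]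

/-- The Cauchy–Schwarz inequality in time for a positive semidefinite form. With `z = ∫ φ` and
`l = t - s`, it is the integral of `0 ≤ B(z - l φ, z - l φ)`. -/
theorem form_integral_le [CompleteSpace E] (B : E →L[ℝ] E →L[ℝ] ℝ)
    (hsymm : ∀ x y, B x y = B y x) (hpos : ∀ x, 0 ≤ B x x) {φ : ℝ → E} {s t : ℝ} (hst : s ≤ t)
    (hφ : IntervalIntegrable φ volume s t)
    (hBφ : IntervalIntegrable (fun r => B (φ r) (φ r)) volume s t) :
    B (∫ r in s..t, φ r) (∫ r in s..t, φ r) ≤ (t - s) * ∫ r in s..t, B (φ r) (φ r) := by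
  rcases hst.eq_or_lt with rfl | hlt
  · simp
  set z := ∫ r in s..t, φ r with hz
  set l := t - s with hl
  have hlpos : 0 < l := sub_pos.2 hlt
  have h1 : ∫ r in s..t, B z (φ r) = B z z := (B z).intervalIntegral_comp_comm hφ
  have hi1 : IntervalIntegrable (fun r => B z (φ r)) volume s t :=
    intervalIntegrable_clm_comp (B z) hφ
  have h2 : 0 ≤ ∫ r in s..t, (B z z - 2 * l * B z (φ r) + l ^ 2 * B (φ r) (φ r)) := by
    refine intervalIntegral.integral_nonneg hst fun r _ => ?_
    have := hpos (z - l • φ r)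
    simp only [map_sub, map_smul, sub_apply, smul_apply,
      smul_eq_mul] at this
    rw [hsymm (φ r) z] at this
    linarith
  rw [intervalIntegral.integral_add (intervalIntegrable_const.sub (hi1.const_mul _))
    (hBφ.const_mul _), intervalIntegral.integral_sub intervalIntegrable_const (hi1.const_mul _),
    intervalIntegral.integral_const_mul, intervalIntegral.integral_const_mul, h1,
    intervalIntegral.integral_const, smul_eq_mul, ← hl] at h2
  have h3 : l * B z z ≤ l * (l * ∫ r in s..t, B (φ r) (φ r)) := by nlinarith
  exact le_of_mul_le_mul_left h3 hlpos

theorem norm_integral_sq_le {φ : ℝ → E} {s t : ℝ} (hst : s ≤ t)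
    (hφ : IntervalIntegrable φ volume s t)
    (hφ2 : IntervalIntegrable (fun r => ‖φ r‖ ^ 2) volume s t) :
    ‖∫ r in s..t, φ r‖ ^ 2 ≤ (t - s) * ∫ r in s..t, ‖φ r‖ ^ 2 := by
  have h := form_integral_le (ContinuousLinearMap.mul ℝ ℝ) (fun x y => mul_comm x y)
    (fun x => mul_self_nonneg x) hst hφ.norm (by simpa [← sq] using hφ2)
  simp only [ContinuousLinearMap.mul_apply', ← sq] at h
  exact (pow_le_pow_left₀ (norm_nonneg _)
    (intervalIntegral.norm_integral_le_integral_norm hst) 2).trans h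

/-- Proved without a change of the order of integration: with the primitive `Φ` of `φ`, the left
side is `∫ Φ` over `(T - h, T)` minus `∫ Φ` over `(0, h)`. -/
theorem integral_moving_window_le {φ : ℝ → ℝ} (hφ0 : ∀ t, 0 ≤ φ t) {T h : ℝ} (hh : 0 ≤ h)
    (hhT : h ≤ T) (hφ : IntervalIntegrable φ volume 0 T) :
    IntervalIntegrable (fun t => ∫ r in t..(t + h), φ r) volume 0 (T - h) ∧
    ∫ t in (0 : ℝ)..(T - h), ∫ r in t..(t + h), φ r ≤ h * ∫ r in (0 : ℝ)..T, φ r := by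
  set Φ : ℝ → ℝ := fun t => ∫ r in (0 : ℝ)..t, φ r with hΦ
  have hT : 0 ≤ T := hh.trans hhT
  have hsub : ∀ {w}, w ∈ Icc 0 T → IntervalIntegrable φ volume 0 w := fun {w} hw =>
    hφ.mono_set (by rw [uIcc_of_le hw.1, uIcc_of_le hT]; exact Icc_subset_Icc_right hw.2)
  have hcont : ContinuousOn Φ (Icc 0 T) :=
    continuousOn_of_eq_add_integral (z := Φ) hφ (fun t _ => by simp [hΦ])
  have hint : ∀ {x y}, x ∈ Icc 0 T → y ∈ Icc 0 T → IntervalIntegrable Φ volume x y :=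
    fun {x y} hx hy => (hcont.mono (uIcc_subset_Icc hx hy)).intervalIntegrable
  have hmono : ∀ x ∈ Icc 0 T, ∀ y ∈ Icc 0 T, x ≤ y → Φ x ≤ Φ y := by
    intro x hx y hy hxy
    have := intervalIntegral.integral_interval_sub_left (hsub hy) (hsub hx)
    have h0 : 0 ≤ ∫ r in x..y, φ r := intervalIntegral.integral_nonneg hxy fun r _ => hφ0 r
    simp only [hΦ]; linarith
  have hm0 : (0 : ℝ) ∈ Icc 0 T := ⟨le_rfl, hT⟩
  have hmT : T ∈ Icc 0 T := ⟨hT, le_rfl⟩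
  have hmh : h ∈ Icc 0 T := ⟨hh, hhT⟩
  have hmTh : T - h ∈ Icc 0 T := ⟨by linarith, by linarith⟩
  have heq : ∀ t ∈ uIcc 0 (T - h), (fun t => Φ (t + h) - Φ t) t = ∫ r in t..(t + h), φ r := by
    intro t ht
    rw [uIcc_of_le hmTh.1] at ht
    exact intervalIntegral.integral_interval_sub_left (hsub ⟨by linarith [ht.1], by linarith [ht.2]⟩)
      (hsub ⟨ht.1, by linarith [ht.2]⟩)
  have hi2 : IntervalIntegrable (fun t => Φ (t + h)) volume 0 (T - h) := by
    have := (hint hmh hmT).comp_add_right h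
    simpa using this
  refine ⟨(hi2.sub (hint hm0 hmTh)).congr fun t ht => heq t (uIoc_subset_uIcc ht), ?_⟩
  rw [← intervalIntegral.integral_congr heq, intervalIntegral.integral_sub hi2 (hint hm0 hmTh),
    intervalIntegral.integral_comp_add_right (fun t => Φ t)]
  have e1 := intervalIntegral.integral_add_adjacent_intervals (hint hmh hmTh) (hint hmTh hmT)
  have e2 := intervalIntegral.integral_add_adjacent_intervals (hint hm0 hmh) (hint hmh hmTh)
  have e3 : ∫ t in (T - h)..T, Φ t ≤ ∫ t in (T - h)..T, Φ T :=
    intervalIntegral.integral_mono_on (by linarith) (hint hmTh hmT) intervalIntegrable_const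
      fun t ht => hmono t ⟨by linarith [ht.1, hmTh.1], ht.2⟩ T hmT ht.2
  have e4 : 0 ≤ ∫ t in (0 : ℝ)..h, Φ t :=
    intervalIntegral.integral_nonneg hh fun t ht =>
      intervalIntegral.integral_nonneg ht.1 fun r _ => hφ0 r
  rw [intervalIntegral.integral_const, smul_eq_mul] at e3
  simp only [zero_add, sub_add_cancel]
  have : T - (T - h) = h := by ring
  rw [this] at e3
  linarith

end Form

/-! ### Energy estimates for the semi-discrete evolution -/

section Evolution

variable {E H : Type*} [NormedAddCommGroup E] [NormedSpace ℝ E]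
  [NormedAddCommGroup H] [InnerProductSpace ℝ H]

theorem continuousOn_form (B : E →L[ℝ] E →L[ℝ] ℝ) {x y : ℝ → E} {s : Set ℝ}
    (hx : ContinuousOn x s) (hy : ContinuousOn y s) : ContinuousOn (fun t => B (x t) (y t)) s :=
  (B.continuous.comp_continuousOn hx).clm_apply hy

theorem functional_le_form {B : E →L[ℝ] E →L[ℝ] ℝ} {c : ℝ} (hc : 0 < c)
    (hcoer : ∀ x, c * ‖x‖ ^ 2 ≤ B x x) (l : StrongDual ℝ E) (x : E) :
    l x ≤ 1 / 2 * B x x + 1 / 2 * (‖l‖ ^ 2 / c) := by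
  have h1 : l x ≤ ‖l‖ * ‖x‖ := (le_abs_self _).trans (l.le_opNorm x)
  have h2 : ‖l‖ * ‖x‖ ≤ 1 / 2 * (c * ‖x‖ ^ 2) + 1 / 2 * (‖l‖ ^ 2 / c) := by
    have h3 : ‖l‖ ^ 2 / c = c * (‖l‖ / c) ^ 2 := by field_simp
    have h4 : ‖l‖ * ‖x‖ = c * ((‖l‖ / c) * ‖x‖) := by field_simp
    rw [h3, h4]
    nlinarith [sq_nonneg (‖l‖ / c - ‖x‖)]
  linarith [hcoer x]

/-- The energy inequality: the term `B(z, z) / 2` on the right of the hypothesis is absorbed. -/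
theorem energy_inequality [CompleteSpace E] [CompleteSpace H] (J : E →L[ℝ] H)
    (B : E →L[ℝ] E →L[ℝ] ℝ) {κ τ : ℝ} {z dz : ℝ → E}
    {q : ℝ → ℝ} (hτ : 0 ≤ τ) (hdz : IntervalIntegrable dz volume 0 τ)
    (hz : ∀ t ∈ Icc 0 τ, z t = z 0 + ∫ s in (0 : ℝ)..t, dz s)
    (hq : IntervalIntegrable q volume 0 τ)
    (hineq : ∀ᵐ t, t ∈ Ioo 0 τ → inner ℝ (J (z t)) (J (dz t)) + B (z t) (z t) ≤
      κ * ‖J (z t)‖ + 1 / 2 * B (z t) (z t) + 1 / 2 * q t) :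
    ‖J (z τ)‖ ^ 2 + ∫ t in (0 : ℝ)..τ, B (z t) (z t) ≤
      ‖J (z 0)‖ ^ 2 + 2 * κ * (∫ t in (0 : ℝ)..τ, ‖J (z t)‖) + ∫ t in (0 : ℝ)..τ, q t := by
  have hzc := continuousOn_of_eq_add_integral hdz hz
  have hJ : ∀ t ∈ Icc 0 τ, J (z t) = J (z 0) + ∫ s in (0 : ℝ)..t, J (dz s) := by
    intro t ht
    rw [J.intervalIntegral_comp_comm (hdz.mono_set (by
      rw [uIcc_of_le ht.1, uIcc_of_le hτ]; exact Icc_subset_Icc_right ht.2)), hz t ht, map_add]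
  obtain ⟨hi, he⟩ := integral_inner_deriv hτ (intervalIntegrable_clm_comp J hdz) hJ
  have hB : IntervalIntegrable (fun t => B (z t) (z t)) volume 0 τ :=
    (continuousOn_form B (by rwa [uIcc_of_le hτ]) (by rwa [uIcc_of_le hτ])).intervalIntegrable
  have hn : IntervalIntegrable (fun t => ‖J (z t)‖) volume 0 τ :=
    (J.continuous.comp_continuousOn (by rwa [uIcc_of_le hτ])).norm.intervalIntegrable
  have hmono : ∫ t in (0 : ℝ)..τ, (2 * inner ℝ (J (z t)) (J (dz t)) + B (z t) (z t)) ≤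
      ∫ t in (0 : ℝ)..τ, (2 * κ * ‖J (z t)‖ + q t) := by
    refine intervalIntegral.integral_mono_ae_restrict hτ (hi.add hB) ((hn.const_mul _).add hq) ?_
    rw [← restrict_Ioo_eq_restrict_Icc]
    refine (ae_restrict_iff' measurableSet_Ioo).2 ?_
    filter_upwards [hineq] with t ht hm
    have := ht hm
    linarith
  rw [intervalIntegral.integral_add hi hB, intervalIntegral.integral_add (hn.const_mul _) hq, he,
    intervalIntegral.integral_const_mul] at hmono
  linarith

/-- `u`, with time derivative `du`, solves the evolution equation
`(Jψ, J ∂ₜu) + B(ψ, u) = (Jψ, g)` for all `ψ ∈ V`, almost everywhere in `(0,T)`, with values in `V` and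
with `u(0) = 0`. The initial condition and the absolute continuity are both contained in
`eq_integral`. The derivative `du` is not required to take values in `V`. -/
structure IsEvolution (J : E →L[ℝ] H) (B : E →L[ℝ] E →L[ℝ] ℝ) (V : Submodule ℝ E) (T : ℝ)
    (g : ℝ → H) (u du : ℝ → E) : Prop where
  mem : ∀ t ∈ Icc 0 T, u t ∈ V
  integrable : IntervalIntegrable du volume 0 T
  eq_integral : ∀ t ∈ Icc 0 T, u t = ∫ s in (0 : ℝ)..t, du s
  eqn : ∀ᵐ t, t ∈ Ioo 0 T → ∀ ψ ∈ V,
    inner ℝ (J ψ) (J (du t)) + B ψ (u t) = inner ℝ (J ψ) (g t)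

/-- `dg` is the time derivative of `g` and `g0` its initial value, tested against `E`: for almost
every `t`, `(g(t), J ·) = (g0, J ·) + ∫₀ᵗ dg` as functionals on `E`, and `dg` is square integrable in
time. -/
structure HasWeakDerivative (J : E →L[ℝ] H) (T : ℝ) (g : ℝ → H) (dg : ℝ → StrongDual ℝ E)
    (g0 : H) : Prop where
  integrable : IntervalIntegrable dg volume 0 T
  integrable_sq : IntervalIntegrable (fun t => ‖dg t‖ ^ 2) volume 0 T
  eq_integral : ∀ᵐ t, t ∈ Ioo 0 T → ∀ ψ,
    inner ℝ (J ψ) (g t) = inner ℝ (J ψ) g0 + (∫ s in (0 : ℝ)..t, dg s) ψ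

variable {J : E →L[ℝ] H} {B : E →L[ℝ] E →L[ℝ] ℝ} {V : Submodule ℝ E} {T : ℝ}
  {g : ℝ → H} {dg : ℝ → StrongDual ℝ E} {g0 : H} {u du : ℝ → E} {c : ℝ}

theorem IsEvolution.apply_zero (hu : IsEvolution J B V T g u du) (hT : 0 ≤ T) : u 0 = 0 := by
  simpa using hu.eq_integral 0 ⟨le_rfl, hT⟩

theorem IsEvolution.eq_add_integral (hu : IsEvolution J B V T g u du) (hT : 0 ≤ T) :
    ∀ t ∈ Icc 0 T, u t = u 0 + ∫ s in (0 : ℝ)..t, du s := by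
  intro t ht
  rw [hu.apply_zero hT, zero_add, hu.eq_integral t ht]

/-- The solution is of order `h` at time `h`, because `g = g0 + ∫ dg` with `g0 ∈ H` and because the dual
norm of `∫₀ᵗ dg` is at most `√h` times the `L²` norm of `dg` for `t ≤ h`. The first part of `g` is
paired with `Ju`, whose largest norm on `[0, h]` is absorbed; the second part is absorbed by
`B(u, u)`. -/
theorem IsEvolution.norm_sq_le [CompleteSpace E] [CompleteSpace H] (hu : IsEvolution J B V T g u du)
    (hg : HasWeakDerivative J T g dg g0) (hc : 0 < c) (hcoer : ∀ x, c * ‖x‖ ^ 2 ≤ B x x)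
    {h : ℝ} (hh : 0 ≤ h) (hhT : h ≤ T) :
    ‖J (u h)‖ ^ 2 ≤ h ^ 2 * (4 * ‖g0‖ ^ 2 + 2 * (∫ t in (0 : ℝ)..T, ‖dg t‖ ^ 2) / c) := by
  have hT : 0 ≤ T := hh.trans hhT
  set D := ∫ t in (0 : ℝ)..T, ‖dg t‖ ^ 2 with hD
  have hD0 : 0 ≤ D := intervalIntegral.integral_nonneg hT fun t _ => by positivity
  have hcont : ContinuousOn (fun t => ‖J (u t)‖) (Icc 0 h) :=
    ((J.continuous.comp_continuousOn (continuousOn_of_eq_add_integral hu.integrable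
      (hu.eq_add_integral hT))).norm).mono (Icc_subset_Icc_right hhT)
  -- The energy inequality is used up to the time `τ` at which `‖J u‖` is largest on `[0, h]`.
  obtain ⟨τ, hτ, hmax⟩ := isCompact_Icc.exists_isMaxOn ⟨0, le_rfl, hh⟩ hcont
  set S := ‖J (u τ)‖ with hS
  have hmaxS : ∀ t ∈ Icc 0 h, ‖J (u t)‖ ≤ S := fun t ht => hmax ht
  have hτT : τ ≤ T := hτ.2.trans hhT
  have hsub : ∀ {a b : ℝ}, 0 ≤ a → a ≤ b → b ≤ T → uIcc a b ⊆ uIcc 0 T := fun ha hab hb => by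
    rw [uIcc_of_le hab, uIcc_of_le hT]; exact Icc_subset_Icc ha hb
  have hen := energy_inequality J B (κ := ‖g0‖) (q := fun _ => h * D / c) hτ.1
    (hu.integrable.mono_set (hsub le_rfl hτ.1 hτT))
    (fun t ht => hu.eq_add_integral hT t ⟨ht.1, ht.2.trans hτT⟩) intervalIntegrable_const (by
      filter_upwards [hu.eqn, hg.eq_integral] with t h1 h2 ht
      have htT : t ∈ Ioo 0 T := ⟨ht.1, ht.2.trans_le hτT⟩
      rw [h1 htT (u t) (hu.mem t (Ioo_subset_Icc_self htT)), h2 htT (u t)]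
      have h3 : inner ℝ (J (u t)) g0 ≤ ‖J (u t)‖ * ‖g0‖ := real_inner_le_norm _ _
      have h4 := functional_le_form hc hcoer (∫ s in (0 : ℝ)..t, dg s) (u t)
      have h5 : ‖∫ s in (0 : ℝ)..t, dg s‖ ^ 2 ≤ h * D := by
        have hs := hsub le_rfl ht.1.le htT.2.le
        refine (norm_integral_sq_le ht.1.le (hg.integrable.mono_set hs)
          (hg.integrable_sq.mono_set hs)).trans ?_
        have h6 : ∫ s in (0 : ℝ)..t, ‖dg s‖ ^ 2 ≤ D :=
          intervalIntegral.integral_mono_interval le_rfl ht.1.le htT.2.le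
            (ae_of_all _ fun s => by positivity) hg.integrable_sq
        have h7 : 0 ≤ ∫ s in (0 : ℝ)..t, ‖dg s‖ ^ 2 :=
          intervalIntegral.integral_nonneg ht.1.le fun s _ => by positivity
        have h8 : t - 0 ≤ h := by linarith [ht.2, hτ.2]
        exact mul_le_mul h8 h6 h7 hh
      have h9 : ‖∫ s in (0 : ℝ)..t, dg s‖ ^ 2 / c ≤ h * D / c := by gcongr
      linarith)
  have hpos : 0 ≤ ∫ t in (0 : ℝ)..τ, B (u t) (u t) :=
    intervalIntegral.integral_nonneg hτ.1 fun t _ => (by positivity : (0 : ℝ) ≤ _).trans (hcoer _)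
  have hint : ∫ t in (0 : ℝ)..τ, ‖J (u t)‖ ≤ τ * S := by
    have := intervalIntegral.integral_mono_on (μ := volume) hτ.1
      (f := fun t => ‖J (u t)‖) (g := fun _ => S)
      (ContinuousOn.intervalIntegrable (by
        rw [uIcc_of_le hτ.1]; exact hcont.mono (Icc_subset_Icc_right hτ.2)))
      intervalIntegrable_const fun t ht => hmaxS t ⟨ht.1, ht.2.trans hτ.2⟩
    simpa using this
  have hS0 : 0 ≤ S := norm_nonneg _
  have hint2 : ∫ t in (0 : ℝ)..τ, ‖J (u t)‖ ≤ h * S :=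
    hint.trans (mul_le_mul_of_nonneg_right hτ.2 hS0)
  have hq : ∫ _ in (0 : ℝ)..τ, h * D / c ≤ h * (h * D / c) := by
    rw [intervalIntegral.integral_const, smul_eq_mul, sub_zero]
    exact mul_le_mul_of_nonneg_right hτ.2 (by positivity)
  rw [hu.apply_zero hT] at hen
  simp only [map_zero, norm_zero] at hen
  have hG := norm_nonneg g0
  have h10 : 2 * ‖g0‖ * (∫ t in (0 : ℝ)..τ, ‖J (u t)‖) ≤ 2 * ‖g0‖ * (h * S) := by gcongr
  have h11 : S ^ 2 ≤ 2 * ‖g0‖ * (h * S) + h * (h * D / c) := by linarith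
  have h12 : S ^ 2 ≤ h ^ 2 * (4 * ‖g0‖ ^ 2 + 2 * D / c) := by
    have : h ^ 2 * (4 * ‖g0‖ ^ 2 + 2 * D / c) = 4 * (h * ‖g0‖) ^ 2 + 2 * (h * (h * D / c)) := by
      ring
    nlinarith [sq_nonneg (S - 2 * (h * ‖g0‖))]
  exact (pow_le_pow_left₀ (norm_nonneg _) (hmaxS h ⟨hh, le_rfl⟩) 2).trans h12

/-- The energy inequality for the increments `z(t) = u(t + h) - u(t)`. They solve the evolution equation
with right-hand side `∫_t^{t+h} dg` and initial value `u(h)`. -/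
theorem IsEvolution.integral_form_increment_le [CompleteSpace E] [CompleteSpace H]
    (hu : IsEvolution J B V T g u du)
    (hg : HasWeakDerivative J T g dg g0) (hc : 0 < c) (hcoer : ∀ x, c * ‖x‖ ^ 2 ≤ B x x)
    {h : ℝ} (hh : 0 ≤ h) (hhT : h ≤ T) :
    ∫ t in (0 : ℝ)..(T - h), B (u (t + h) - u t) (u (t + h) - u t) ≤
      h ^ 2 * (4 * ‖g0‖ ^ 2 + 3 * (∫ t in (0 : ℝ)..T, ‖dg t‖ ^ 2) / c) := by
  have hT : 0 ≤ T := hh.trans hhT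
  have hTh : 0 ≤ T - h := by linarith
  set D := ∫ t in (0 : ℝ)..T, ‖dg t‖ ^ 2 with hD
  have hsub : ∀ {a b : ℝ}, 0 ≤ a → a ≤ b → b ≤ T → uIcc a b ⊆ uIcc 0 T := fun ha hab hb => by
    rw [uIcc_of_le hab, uIcc_of_le hT]; exact Icc_subset_Icc ha hb
  obtain ⟨hwi, hwle⟩ := integral_moving_window_le (φ := fun t => ‖dg t‖ ^ 2)
    (fun t => by positivity) hh hhT hg.integrable_sq
  have hd1 : ∀ {t}, t ∈ Icc 0 (T - h) → IntervalIntegrable (fun s => du (s + h)) volume 0 t := by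
    intro t ht
    have := (hu.integrable.mono_set (hsub (a := h) (b := t + h) hh (by linarith [ht.1])
      (by linarith [ht.2]))).comp_add_right h
    simpa using this
  have hd2 : ∀ {t}, t ∈ Icc 0 (T - h) → IntervalIntegrable du volume 0 t := fun {t} ht =>
    hu.integrable.mono_set (hsub le_rfl ht.1 (by linarith [ht.2]))
  have hmTh : T - h ∈ Icc 0 (T - h) := ⟨hTh, le_rfl⟩
  have hen := energy_inequality J B (κ := 0) (z := fun t => u (t + h) - u t)
    (dz := fun t => du (t + h) - du t) (q := fun t => (h * ∫ r in t..(t + h), ‖dg r‖ ^ 2) / c)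
    hTh ((hd1 hmTh).sub (hd2 hmTh)) (by
      intro t ht
      rw [intervalIntegral.integral_sub (hd1 ht) (hd2 ht),
        intervalIntegral.integral_comp_add_right (fun s => du s),
        ← sub_eq_integral_of_eq_add_integral hu.integrable (hu.eq_add_integral hT)
          (x := 0 + h) (y := t + h) ⟨by linarith, by linarith⟩
          ⟨by linarith [ht.1], by linarith [ht.2]⟩,
        ← sub_eq_integral_of_eq_add_integral hu.integrable (hu.eq_add_integral hT)
          (x := 0) (y := t) ⟨le_rfl, hT⟩ ⟨ht.1, by linarith [ht.2]⟩]
      abel) ((hwi.const_mul h).div_const c) (by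
      have hshift : ∀ {p : ℝ → Prop}, (∀ᵐ t, p t) → ∀ᵐ t, p (t + h) := fun hp =>
        (measurePreserving_add_right volume h).quasiMeasurePreserving.ae hp
      filter_upwards [hu.eqn, hg.eq_integral, hshift hu.eqn, hshift hg.eq_integral]
        with t h1 h2 h3 h4 ht
      have ht1 : t ∈ Ioo 0 T := ⟨ht.1, by linarith [ht.2]⟩
      have ht2 : t + h ∈ Ioo 0 T := ⟨by linarith [ht.1], by linarith [ht.2]⟩
      set ψ := u (t + h) - u t with hψ
      have hψV : ψ ∈ V := V.sub_mem (hu.mem _ (Ioo_subset_Icc_self ht2))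
        (hu.mem _ (Ioo_subset_Icc_self ht1))
      have e1 := h1 ht1 ψ hψV
      have e3 := h3 ht2 ψ hψV
      rw [h2 ht1 ψ] at e1
      rw [h4 ht2 ψ] at e3
      have hdgs := intervalIntegral.integral_interval_sub_left
        (hg.integrable.mono_set (hsub le_rfl ht2.1.le ht2.2.le))
        (hg.integrable.mono_set (hsub le_rfl ht1.1.le ht1.2.le))
      have e5 : B ψ ψ = B ψ (u (t + h)) - B ψ (u t) := by rw [← map_sub]
      have e6 : (∫ s in t..(t + h), dg s) ψ =
          (∫ s in (0 : ℝ)..(t + h), dg s) ψ - (∫ s in (0 : ℝ)..t, dg s) ψ := by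
        rw [← hdgs, sub_apply]
      have e7 := functional_le_form hc hcoer (∫ s in t..(t + h), dg s) ψ
      have hs := hsub (a := t) (b := t + h) ht1.1.le (by linarith) ht2.2.le
      have e8 := norm_integral_sq_le (by linarith : t ≤ t + h) (hg.integrable.mono_set hs)
        (hg.integrable_sq.mono_set hs)
      rw [add_sub_cancel_left] at e8
      have e9 : ‖∫ s in t..(t + h), dg s‖ ^ 2 / c ≤ (h * ∫ r in t..(t + h), ‖dg r‖ ^ 2) / c := by
        gcongr
      rw [map_sub J (du (t + h)), inner_sub_right]
      linarith)
  simp only [zero_add, hu.apply_zero hT, sub_zero, mul_zero, zero_mul, add_zero] at hen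
  rw [intervalIntegral.integral_div, intervalIntegral.integral_const_mul] at hen
  have hu0 := hu.norm_sq_le hg hc hcoer hh hhT
  have h2 : h * (∫ t in (0 : ℝ)..(T - h), ∫ r in t..(t + h), ‖dg r‖ ^ 2) / c ≤
      h * (h * D) / c := by gcongr
  have h3 : h ^ 2 * (4 * ‖g0‖ ^ 2 + 3 * D / c) =
      h ^ 2 * (4 * ‖g0‖ ^ 2 + 2 * D / c) + h * (h * D) / c := by ring
  have h4 : 0 ≤ ‖J (u (T - h + h) - u (T - h))‖ ^ 2 := by positivity
  linarith

end Evolution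

/-! ### The time derivative in the energy norm and the error of one step -/

section Scheme

variable {E H : Type*} [NormedAddCommGroup E] [NormedSpace ℝ E]
  [NormedAddCommGroup H] [InnerProductSpace ℝ H]
  {J : E →L[ℝ] H} {B : E →L[ℝ] E →L[ℝ] ℝ} {V : Submodule ℝ E} {T : ℝ}
  {g : ℝ → H} {dg : ℝ → StrongDual ℝ E} {g0 : H} {u du : ℝ → E} {c : ℝ}

/-- The regularity bound for `∂ₜu` in the energy norm. Almost everywhere the difference quotients of
`u` converge to `du`, so Fatou's lemma applies to the bound for the increments. -/
theorem IsEvolution.integral_form_deriv_le [CompleteSpace E] [CompleteSpace H]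
    (hu : IsEvolution J B V T g u du)
    (hg : HasWeakDerivative J T g dg g0) (hc : 0 < c) (hcoer : ∀ x, c * ‖x‖ ^ 2 ≤ B x x)
    (hT : 0 < T) :
    IntervalIntegrable (fun t => B (du t) (du t)) volume 0 T ∧
    ∫ t in (0 : ℝ)..T, B (du t) (du t) ≤
      4 * ‖g0‖ ^ 2 + 3 * (∫ t in (0 : ℝ)..T, ‖dg t‖ ^ 2) / c := by
  have hpos : ∀ x, 0 ≤ B x x := fun x => (by positivity : (0 : ℝ) ≤ _).trans (hcoer x)
  set K := 4 * ‖g0‖ ^ 2 + 3 * (∫ t in (0 : ℝ)..T, ‖dg t‖ ^ 2) / c with hK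
  have hK0 : 0 ≤ K := by
    have : 0 ≤ ∫ t in (0 : ℝ)..T, ‖dg t‖ ^ 2 :=
      intervalIntegral.integral_nonneg hT.le fun t _ => by positivity
    positivity
  have hucont := continuousOn_of_eq_add_integral hu.integrable (hu.eq_add_integral hT.le)
  let h : ℕ → ℝ := fun n => T / (n + 1)
  have hh0 : ∀ n, 0 < h n := fun n => by positivity
  have hhT : ∀ n, h n ≤ T := fun n => div_le_self hT.le (by linarith [n.cast_nonneg (α := ℝ)])
  have hlim : Tendsto h atTop (𝓝 0) := by
    simpa [h, div_eq_mul_inv] using tendsto_one_div_add_atTop_nhds_zero_nat.const_mul T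
  let Q : ℕ → ℝ → ℝ := fun n t =>
    B ((h n)⁻¹ • (u (t + h n) - u t)) ((h n)⁻¹ • (u (t + h n) - u t))
  let F : ℕ → ℝ → ℝ≥0∞ := fun n =>
    (Ioo 0 (T - h n)).indicator fun t => ENNReal.ofReal (Q n t)
  have hQcont : ∀ n, ContinuousOn (Q n) (Icc 0 (T - h n)) := by
    intro n
    have h1 : ContinuousOn (fun t => (h n)⁻¹ • (u (t + h n) - u t)) (Icc 0 (T - h n)) := by
      refine ContinuousOn.const_smul (ContinuousOn.sub ?_ ?_) _
      · refine hucont.comp (by fun_prop) fun t ht => ⟨?_, ?_⟩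
        · linarith [ht.1, hh0 n]
        · linarith [ht.2]
      · exact hucont.mono (Icc_subset_Icc_right (by linarith [hh0 n]))
    exact continuousOn_form B h1 h1
  have hQint : ∀ n, IntegrableOn (Q n) (Ioo 0 (T - h n)) := fun n =>
    ((hQcont n).integrableOn_compact isCompact_Icc).mono_set Ioo_subset_Icc_self
  have hFle : ∀ n, ∫⁻ t in Ioo 0 T, F n t ≤ ENNReal.ofReal K := by
    intro n
    have h1 : ∫⁻ t in Ioo 0 T, F n t ≤ ∫⁻ t, F n t := setLIntegral_le_lintegral _ _
    refine h1.trans ?_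
    rw [lintegral_indicator measurableSet_Ioo, ← ofReal_integral_eq_lintegral_ofReal (hQint n)
      (ae_of_all _ fun t => hpos _)]
    refine ENNReal.ofReal_le_ofReal ?_
    rw [← integral_Ioc_eq_integral_Ioo, ← intervalIntegral.integral_of_le (by linarith [hhT n])]
    have h2 := hu.integral_form_increment_le hg hc hcoer (hh0 n).le (hhT n)
    have h3 : ∀ t, Q n t = ((h n) ^ 2)⁻¹ * B (u (t + h n) - u t) (u (t + h n) - u t) := by
      intro t
      simp only [Q, map_smul, smul_apply, smul_eq_mul]
      ring
    simp only [h3]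
    rw [intervalIntegral.integral_const_mul, inv_mul_le_iff₀ (pow_pos (hh0 n) 2)]
    exact h2
  have hFmeas : ∀ n, AEMeasurable (F n) (volume.restrict (Ioo 0 T)) := by
    intro n
    have : AEMeasurable (F n) volume := by
      rw [aemeasurable_indicator_iff measurableSet_Ioo]
      exact (hQint n).aestronglyMeasurable.aemeasurable.ennreal_ofReal
    exact this.restrict
  have hFlim : ∀ᵐ t ∂(volume.restrict (Ioo 0 T)),
      Tendsto (fun n => F n t) atTop (𝓝 (ENNReal.ofReal (B (du t) (du t)))) := by
    refine (ae_restrict_iff' measurableSet_Ioo).2 ?_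
    filter_upwards [ae_hasDerivAt_of_eq_add_integral hu.integrable (hu.eq_add_integral hT.le)]
      with t ht hm
    have h1 : Tendsto h atTop (𝓝[≠] 0) :=
      tendsto_nhdsWithin_iff.2 ⟨hlim, Eventually.of_forall fun n => (hh0 n).ne'⟩
    have h2 := (hasDerivAt_iff_tendsto_slope_zero.1 (ht hm)).comp h1
    have h3 : Tendsto (fun n => Q n t) atTop (𝓝 (B (du t) (du t))) :=
      ((B.continuous.clm_apply continuous_id).tendsto (du t)).comp h2
    refine (ENNReal.tendsto_ofReal h3).congr' ?_
    have h4 : ∀ᶠ n in atTop, h n < T - t :=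
      hlim.eventually (gt_mem_nhds (by linarith [hm.2]))
    filter_upwards [h4] with n hn
    have hmem : t ∈ Ioo 0 (T - h n) := ⟨hm.1, by linarith⟩
    simp only [F, indicator_of_mem hmem]
  have hle : ∫⁻ t in Ioo 0 T, ENNReal.ofReal (B (du t) (du t)) ≤ ENNReal.ofReal K := by
    calc ∫⁻ t in Ioo 0 T, ENNReal.ofReal (B (du t) (du t))
        = ∫⁻ t in Ioo 0 T, liminf (fun n => F n t) atTop :=
          lintegral_congr_ae (hFlim.mono fun t ht => ht.liminf_eq.symm)
      _ ≤ liminf (fun n => ∫⁻ t in Ioo 0 T, F n t) atTop := lintegral_liminf_le' hFmeas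
      _ ≤ ENNReal.ofReal K := by
          refine (liminf_le_liminf (Eventually.of_forall hFle)).trans ?_
          simp
  have hmeas : AEStronglyMeasurable (fun t => B (du t) (du t)) (volume.restrict (Ioo 0 T)) := by
    have h1 : AEStronglyMeasurable du (volume.restrict (Ioo 0 T)) :=
      hu.integrable.1.aestronglyMeasurable.mono_set Ioo_subset_Ioc_self
    have h2 : Continuous fun x : E => B x x := B.continuous.clm_apply continuous_id
    exact h2.comp_aestronglyMeasurable h1
  have hint : IntegrableOn (fun t => B (du t) (du t)) (Ioo 0 T) :=
    (lintegral_ofReal_ne_top_iff_integrable hmeas (ae_of_all _ fun t => hpos _)).1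
      (ne_top_of_le_ne_top ENNReal.ofReal_ne_top hle)
  refine ⟨(intervalIntegrable_iff_integrableOn_Ioo_of_le hT.le).2 hint, ?_⟩
  rw [intervalIntegral.integral_of_le hT.le, integral_Ioc_eq_integral_Ioo]
  rw [← ofReal_integral_eq_lintegral_ofReal hint (ae_of_all _ fun t => hpos _)] at hle
  exact (ENNReal.ofReal_le_ofReal_iff hK0).1 hle

/-- Consistency of the scheme in time: on `(x, y)` the solution differs from its final value `u(y)` by
the integral of `du`, which is of order `y - x` in the energy norm, in the mean square. -/
theorem IsEvolution.form_sub_le [CompleteSpace E] (hu : IsEvolution J B V T g u du)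
    (hsymm : ∀ x y, B x y = B y x) (hpos : ∀ x, 0 ≤ B x x)
    (hdu : IntervalIntegrable (fun t => B (du t) (du t)) volume 0 T) {x y t : ℝ}
    (hx : 0 ≤ x) (hxt : x ≤ t) (hty : t ≤ y) (hy : y ≤ T) :
    B (u y - u t) (u y - u t) ≤ (y - x) * ∫ s in x..y, B (du s) (du s) := by
  have hT : 0 ≤ T := by linarith
  have hsub : ∀ {a b : ℝ}, 0 ≤ a → a ≤ b → b ≤ T → uIcc a b ⊆ uIcc 0 T := fun ha hab hb => by
    rw [uIcc_of_le hab, uIcc_of_le hT]; exact Icc_subset_Icc ha hb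
  have hs := hsub (hx.trans hxt) hty hy
  rw [sub_eq_integral_of_eq_add_integral hu.integrable (hu.eq_add_integral hT)
    ⟨hx.trans hxt, hty.trans hy⟩ ⟨by linarith, hy⟩]
  refine (form_integral_le B hsymm hpos hty (hu.integrable.mono_set hs) (hdu.mono_set hs)).trans ?_
  have h1 : ∫ s in t..y, B (du s) (du s) ≤ ∫ s in x..y, B (du s) (du s) :=
    intervalIntegral.integral_mono_interval hxt hty le_rfl (ae_of_all _ fun s => hpos _)
      (hdu.mono_set (hsub hx (hxt.trans hty) hy))
  have h2 : 0 ≤ ∫ s in t..y, B (du s) (du s) :=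
    intervalIntegral.integral_nonneg hty fun s _ => hpos _
  exact mul_le_mul (by linarith) h1 h2 (by linarith)

/-- The error recursion over one step `(x, y)` of the implicit scheme, from the value `v` to the value
`w`: the difference of the two equations is tested with the new error `ψ = u(y) - w`. -/
theorem IsEvolution.error_step_le [CompleteSpace E] [CompleteSpace H]
    (hu : IsEvolution J B V T g u du)
    (hg : ∀ ψ, IntervalIntegrable (fun t => inner ℝ (J ψ) (g t)) volume 0 T)
    (hsymm : ∀ x y, B x y = B y x) (hpos : ∀ x, 0 ≤ B x x)
    (hdu : IntervalIntegrable (fun t => B (du t) (du t)) volume 0 T) {x y : ℝ}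
    (hx : 0 ≤ x) (hxy : x ≤ y) (hy : y ≤ T) {v w : E} (hw : w ∈ V)
    (hstep : ∀ ψ ∈ V, inner ℝ (J ψ) (J w) = inner ℝ (J ψ) (J v) +
      ∫ t in x..y, (-B ψ w + inner ℝ (J ψ) (g t))) :
    ‖J (u y - w)‖ ^ 2 + (y - x) * B (u y - w) (u y - w) ≤
      ‖J (u x - v)‖ ^ 2 + (y - x) ^ 2 * ∫ s in x..y, B (du s) (du s) := by
  have hT : 0 ≤ T := by linarith
  have hs : uIcc x y ⊆ uIcc 0 T := by
    rw [uIcc_of_le hxy, uIcc_of_le hT]; exact Icc_subset_Icc hx hy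
  set ψ := u y - w with hψ
  have hψV : ψ ∈ V := V.sub_mem (hu.mem y ⟨hx.trans hxy, hy⟩) hw
  have hucont : ContinuousOn u (uIcc x y) :=
    (continuousOn_of_eq_add_integral hu.integrable (hu.eq_add_integral hT)).mono
      (by rwa [uIcc_of_le hT] at hs)
  have hdux := hu.integrable.mono_set hs
  have hgx := (hg ψ).mono_set hs
  have hBu : IntervalIntegrable (fun t => B ψ (u t)) volume x y :=
    ((B ψ).continuous.comp_continuousOn hucont).intervalIntegrable
  have hJd : IntervalIntegrable (fun t => inner ℝ (J ψ) (J (du t))) volume x y :=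
    intervalIntegrable_clm_comp ((innerSL ℝ (J ψ)).comp J) hdux
  have e1 : ∫ t in x..y, (inner ℝ (J ψ) (J (du t)) + B ψ (u t)) =
      ∫ t in x..y, inner ℝ (J ψ) (g t) := by
    refine intervalIntegral.integral_congr_ae ?_
    filter_upwards [hu.eqn, (by simp [ae_iff, measure_singleton] : ∀ᵐ t : ℝ, t ≠ T)]
      with t ht hne hm
    rw [uIoc_of_le hxy] at hm
    exact ht ⟨hx.trans_lt hm.1, lt_of_le_of_ne (hm.2.trans hy) hne⟩ ψ hψV
  have e2 : ∫ t in x..y, inner ℝ (J ψ) (J (du t)) = inner ℝ (J ψ) (J (u y - u x)) := by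
    rw [sub_eq_integral_of_eq_add_integral hu.integrable (hu.eq_add_integral hT)
      ⟨hx, hxy.trans hy⟩ ⟨hx.trans hxy, hy⟩]
    exact ((innerSL ℝ (J ψ)).comp J).intervalIntegral_comp_comm hdux
  have e3 := hstep ψ hψV
  rw [intervalIntegral.integral_add hJd hBu, e2] at e1
  rw [intervalIntegral.integral_add intervalIntegrable_const hgx,
    intervalIntegral.integral_const, smul_eq_mul, ← e1] at e3
  set b := ∫ s in x..y, B (du s) (du s) with hb
  -- The consistency error: `B` is evaluated at `u(y)` instead of `u(t)`.
  have e4 : (y - x) * B ψ (u y) - ∫ t in x..y, B ψ (u t) ≤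
      1 / 2 * (y - x) * B ψ ψ + 1 / 2 * ((y - x) ^ 2 * b) := by
    have h1 : (y - x) * B ψ (u y) - ∫ t in x..y, B ψ (u t) =
        ∫ t in x..y, (B ψ (u y) - B ψ (u t)) := by
      rw [intervalIntegral.integral_sub intervalIntegrable_const hBu,
        intervalIntegral.integral_const, smul_eq_mul]
    have h2 : ∫ t in x..y, (B ψ (u y) - B ψ (u t)) ≤
        ∫ _ in x..y, (1 / 2 * B ψ ψ + 1 / 2 * ((y - x) * b)) := by
      refine intervalIntegral.integral_mono_on hxy (intervalIntegrable_const.sub hBu)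
        intervalIntegrable_const fun t ht => ?_
      have h3 := hu.form_sub_le hsymm hpos hdu hx ht.1 ht.2 hy
      have h4 := hpos (ψ - (u y - u t))
      have h5 : B (ψ - (u y - u t)) (ψ - (u y - u t)) =
          B ψ ψ - 2 * (B ψ (u y) - B ψ (u t)) + B (u y - u t) (u y - u t) := by
        rw [← map_sub (B ψ)]
        generalize u y - u t = r
        simp only [map_sub, sub_apply]
        rw [hsymm r ψ]
        ring
      linarith
    rw [h1]
    refine h2.trans_eq ?_
    rw [intervalIntegral.integral_const, smul_eq_mul]
    ring
  have e5 : B ψ ψ = B ψ (u y) - B ψ w := by rw [← map_sub]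
  have e6 : inner ℝ (J ψ) (J ψ) = inner ℝ (J ψ) (J (u y - u x)) + inner ℝ (J ψ) (J (u x - v))
      - (inner ℝ (J ψ) (J w) - inner ℝ (J ψ) (J v)) := by
    rw [← inner_sub_right, ← inner_add_right, ← inner_sub_right, ← map_sub, ← map_add, ← map_sub]
    congr 2
    rw [hψ]; abel
  have e7 : inner ℝ (J ψ) (J (u x - v)) ≤ 1 / 2 * ‖J ψ‖ ^ 2 + 1 / 2 * ‖J (u x - v)‖ ^ 2 := by
    have := real_inner_le_norm (J ψ) (J (u x - v))
    nlinarith [sq_nonneg (‖J ψ‖ - ‖J (u x - v)‖)]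
  rw [real_inner_self_eq_norm_sq] at e6
  have e8 : (y - x) * B ψ ψ = (y - x) * B ψ (u y) - (y - x) * B ψ w := by rw [e5]; ring
  linarith

/-- The `L²` error in time over one step, where the discrete solution has the constant value `w`, is
controlled by the error at the end of the step and the oscillation of `u`. -/
theorem IsEvolution.integral_error_le [CompleteSpace E] (hu : IsEvolution J B V T g u du)
    (hsymm : ∀ x y, B x y = B y x) (hc : 0 < c) (hcoer : ∀ x, c * ‖x‖ ^ 2 ≤ B x x)
    (hdu : IntervalIntegrable (fun t => B (du t) (du t)) volume 0 T) {x y : ℝ}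
    (hx : 0 ≤ x) (hxy : x ≤ y) (hy : y ≤ T) (w : E) :
    c * ∫ t in x..y, ‖u t - w‖ ^ 2 ≤ 2 * ((y - x) * B (u y - w) (u y - w)) +
      2 * ((y - x) ^ 2 * ∫ s in x..y, B (du s) (du s)) := by
  have hT : 0 ≤ T := by linarith
  have hpos : ∀ x, 0 ≤ B x x := fun x => (by positivity : (0 : ℝ) ≤ _).trans (hcoer x)
  have hucont : ContinuousOn u (uIcc x y) :=
    (continuousOn_of_eq_add_integral hu.integrable (hu.eq_add_integral hT)).mono
      (by rw [uIcc_of_le hxy]; exact Icc_subset_Icc hx hy)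
  set b := ∫ s in x..y, B (du s) (du s) with hb
  rw [← intervalIntegral.integral_const_mul]
  have h2 : ∫ t in x..y, c * ‖u t - w‖ ^ 2 ≤
      ∫ _ in x..y, (2 * B (u y - w) (u y - w) + 2 * ((y - x) * b)) := by
    refine intervalIntegral.integral_mono_on hxy ?_ intervalIntegrable_const fun t ht => ?_
    · exact (continuousOn_const.mul ((hucont.sub continuousOn_const).norm.pow 2)).intervalIntegrable
    have h3 := hu.form_sub_le hsymm hpos hdu hx ht.1 ht.2 hy
    have h4 := hpos ((u y - w) + (u y - u t))
    have h5 := hcoer (u t - w)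
    have h6 : u t - w = (u y - w) - (u y - u t) := by abel
    rw [h6] at h5 ⊢
    simp only [map_add, add_apply] at h4
    simp only [map_sub, sub_apply] at h3 h4 h5 ⊢
    linarith
  refine h2.trans_eq ?_
  rw [intervalIntegral.integral_const, smul_eq_mul]
  ring

end Scheme

/-! ### The error of the implicit Euler scheme -/

section Abstract

variable {E H : Type*} [NormedAddCommGroup E] [NormedSpace ℝ E]
  [NormedAddCommGroup H] [InnerProductSpace ℝ H]
  {J : E →L[ℝ] H} {B : E →L[ℝ] E →L[ℝ] ℝ} {V : Submodule ℝ E} {T : ℝ}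
  {g : ℝ → H} {dg : ℝ → StrongDual ℝ E} {g0 : H} {u du : ℝ → E} {c : ℝ}

theorem node_succ (T : ℝ) (M m : ℕ) : node T M (m + 1) = node T M m + T / M := by
  simp only [node]; push_cast; ring

/-- The error estimate for the implicit Euler scheme, with a constant that depends only on the
coercivity constant `c`. -/
theorem IsEvolution.implicit_euler_error_le [CompleteSpace E] [CompleteSpace H]
    (hu : IsEvolution J B V T g u du) (hg : HasWeakDerivative J T g dg g0)
    (hgi : ∀ ψ, IntervalIntegrable (fun t => inner ℝ (J ψ) (g t)) volume 0 T)
    (hsymm : ∀ x y, B x y = B y x) (hc : 0 < c) (hcoer : ∀ x, c * ‖x‖ ^ 2 ≤ B x x)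
    (hT : 0 < T) {M : ℕ} (hM : 0 < M) {v : ℝ → E} (hvV : ∀ t ∈ Icc 0 T, v t ∈ V)
    (hv : ∀ m < M, ∀ t ∈ Ioc (node T M m) (node T M (m + 1)), v t = v (node T M (m + 1)))
    (hv0 : v 0 = 0)
    (hstep : ∀ m < M, ∀ ψ ∈ V, inner ℝ (J ψ) (J (v (node T M (m + 1)))) =
      inner ℝ (J ψ) (J (v (node T M m))) + ∫ t in (node T M m)..(node T M (m + 1)),
        (-B ψ (v (node T M (m + 1))) + inner ℝ (J ψ) (g t))) :
    ‖J (u T - v T)‖ + normL2Time T (fun t => u t - v t) ≤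
      (1 + 2 / √c) * (2 + √(3 / c)) * (T / M) * (normL2Time T dg + ‖g0‖) := by
  have hpos : ∀ x, 0 ≤ B x x := fun x => (by positivity : (0 : ℝ) ≤ _).trans (hcoer x)
  obtain ⟨hdu, hK⟩ := hu.integral_form_deriv_le hg hc hcoer hT
  set D := ∫ t in (0 : ℝ)..T, ‖dg t‖ ^ 2 with hD
  have hD0 : 0 ≤ D := intervalIntegral.integral_nonneg hT.le fun t _ => by positivity
  set K := 4 * ‖g0‖ ^ 2 + 3 * D / c with hKdef
  set k := T / M with hk
  have hM' : (0 : ℝ) < M := by exact_mod_cast hM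
  have hk0 : 0 < k := by positivity
  have hMk : M * k = T := by rw [hk]; field_simp
  let τ : ℕ → ℝ := node T M
  have hτ0 : τ 0 = 0 := by simp [τ, node]
  have hτM : τ M = T := by simpa [τ, node] using hMk
  have hτs : ∀ m, τ (m + 1) = τ m + k := node_succ T M
  have hτnn : ∀ m, 0 ≤ τ m := fun m => by simp only [τ, node]; positivity
  have hτle : ∀ m ≤ M, τ m ≤ T := by
    intro m hm
    rw [← hMk]
    exact mul_le_mul_of_nonneg_right (by exact_mod_cast hm) hk0.le
  have hτlt : ∀ m, τ m ≤ τ (m + 1) := fun m => by rw [hτs]; linarith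
  have hτk : ∀ m, τ (m + 1) - τ m = k := fun m => by rw [hτs]; ring
  let e : ℕ → E := fun m => u (τ m) - v (τ m)
  let b : ℕ → ℝ := fun m => ∫ s in (τ m)..(τ (m + 1)), B (du s) (du s)
  have hIsub : ∀ m < M, uIcc (τ m) (τ (m + 1)) ⊆ uIcc 0 T := fun m hm => by
    rw [uIcc_of_le (hτlt m), uIcc_of_le hT.le]
    exact Icc_subset_Icc (hτnn m) (hτle _ hm)
  have hb : ∑ m ∈ Finset.range M, b m ≤ K := by
    have := intervalIntegral.sum_integral_adjacent_intervals (a := τ) (n := M)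
      (f := fun s => B (du s) (du s)) (μ := volume) fun m hm => hdu.mono_set (hIsub m hm)
    simp only [b]
    rw [this, hτ0, hτM]
    exact hK
  have hsteps : ∀ m ≤ M, ‖J (e m)‖ ^ 2 + ∑ j ∈ Finset.range m, k * B (e (j + 1)) (e (j + 1)) ≤
      ∑ j ∈ Finset.range m, k ^ 2 * b j := by
    intro m
    induction m with
    | zero => intro _; simp [e, hτ0, hv0, hu.apply_zero hT.le]
    | succ m ih =>
      intro hm
      have h1 := ih (Nat.le_of_succ_le hm)
      have h2 := hu.error_step_le hgi hsymm hpos hdu (hτnn m) (hτlt m) (hτle _ hm)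
        (hvV (τ (m + 1)) ⟨hτnn _, hτle _ hm⟩) (hstep m hm)
      rw [hτk] at h2
      rw [Finset.sum_range_succ, Finset.sum_range_succ]
      change ‖J (e (m + 1))‖ ^ 2 + k * B (e (m + 1)) (e (m + 1)) ≤ ‖J (e m)‖ ^ 2 + k ^ 2 * b m at h2
      linarith
  have hfin := hsteps M le_rfl
  rw [← Finset.mul_sum, ← Finset.mul_sum] at hfin
  have hbk : k ^ 2 * ∑ m ∈ Finset.range M, b m ≤ k ^ 2 * K := by gcongr
  have hS0 : 0 ≤ ∑ m ∈ Finset.range M, B (e (m + 1)) (e (m + 1)) :=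
    Finset.sum_nonneg fun m _ => hpos _
  have hK0 : 0 ≤ K := by positivity
  have hend : ‖J (u T - v T)‖ ≤ k * √K := by
    have h1 : ‖J (e M)‖ ^ 2 ≤ k ^ 2 * K := by
      have := mul_nonneg hk0.le hS0
      linarith
    have h2 : ‖J (e M)‖ ≤ k * √K := by
      refine le_of_sq_le_sq ?_ (by positivity)
      rwa [mul_pow, Real.sq_sqrt hK0]
    simpa [e, hτM] using h2
  have hucont := continuousOn_of_eq_add_integral hu.integrable (hu.eq_add_integral hT.le)
  have hloc : ∀ m < M,
      IntervalIntegrable (fun t => ‖u t - v t‖ ^ 2) volume (τ m) (τ (m + 1)) ∧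
      c * ∫ t in (τ m)..(τ (m + 1)), ‖u t - v t‖ ^ 2 ≤
        2 * (k * B (e (m + 1)) (e (m + 1))) + 2 * (k ^ 2 * b m) := by
    intro m hm
    have h1 : EqOn (fun t => ‖u t - v (τ (m + 1))‖ ^ 2) (fun t => ‖u t - v t‖ ^ 2)
        (uIoc (τ m) (τ (m + 1))) := by
      intro t ht
      rw [uIoc_of_le (hτlt m)] at ht
      simp only [hv m hm t ht]
      rfl
    have h2 : IntervalIntegrable (fun t => ‖u t - v (τ (m + 1))‖ ^ 2) volume (τ m) (τ (m + 1)) := by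
      refine ContinuousOn.intervalIntegrable (ContinuousOn.pow (ContinuousOn.norm
        (ContinuousOn.sub (hucont.mono ?_) continuousOn_const)) 2)
      simpa only [uIcc_of_le hT.le] using hIsub m hm
    refine ⟨h2.congr h1, ?_⟩
    have h3 := hu.integral_error_le hsymm hc hcoer hdu (hτnn m) (hτlt m) (hτle _ hm)
      (v (τ (m + 1)))
    rw [hτk] at h3
    rwa [← intervalIntegral.integral_congr_ae (ae_of_all _ fun t ht => h1 ht)]
  have hL2 : c * ∫ t in (0 : ℝ)..T, ‖u t - v t‖ ^ 2 ≤ 4 * (k ^ 2 * K) := by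
    have h1 := intervalIntegral.sum_integral_adjacent_intervals (a := τ) (n := M)
      (f := fun t => ‖u t - v t‖ ^ 2) (μ := volume) fun m hm => (hloc m hm).1
    rw [hτ0, hτM] at h1
    rw [← h1, Finset.mul_sum]
    refine (Finset.sum_le_sum fun m hm => (hloc m (Finset.mem_range.1 hm)).2).trans ?_
    rw [Finset.sum_add_distrib, ← Finset.mul_sum, ← Finset.mul_sum, ← Finset.mul_sum,
      ← Finset.mul_sum]
    have := sq_nonneg ‖J (e M)‖
    linarith
  have hnorm : normL2Time T (fun t => u t - v t) ≤ 2 / √c * (k * √K) := by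
    have hsc : 0 < √c := Real.sqrt_pos.2 hc
    refine Real.sqrt_le_iff.2 ⟨by positivity, ?_⟩
    rw [mul_pow, mul_pow, div_pow, Real.sq_sqrt hK0, Real.sq_sqrt hc.le, div_mul_eq_mul_div,
      le_div_iff₀ hc]
    linarith
  have hsqrt : √K ≤ (2 + √(3 / c)) * (normL2Time T dg + ‖g0‖) := by
    have hn : normL2Time T dg = √D := rfl
    rw [hn]
    have h1 : 3 * D / c = (√(3 / c) * √D) ^ 2 := by
      rw [mul_pow, Real.sq_sqrt hD0, Real.sq_sqrt (by positivity)]; ring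
    refine Real.sqrt_le_iff.2 ⟨by positivity, ?_⟩
    rw [hKdef, h1]
    have h2 : (0 : ℝ) ≤ √D := Real.sqrt_nonneg _
    have h3 : (0 : ℝ) ≤ √(3 / c) := Real.sqrt_nonneg _
    have h4 := norm_nonneg g0
    have h5 : 4 * ‖g0‖ ^ 2 + (√(3 / c) * √D) ^ 2 ≤ (2 * ‖g0‖ + √(3 / c) * √D) ^ 2 := by
      nlinarith [mul_nonneg h4 (mul_nonneg h3 h2)]
    refine h5.trans (pow_le_pow_left₀ (by positivity) ?_ 2)
    nlinarith [mul_nonneg h3 h4]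
  have hsc : 0 ≤ 2 / √c := by positivity
  calc ‖J (u T - v T)‖ + normL2Time T (fun t => u t - v t)
      ≤ (1 + 2 / √c) * k * √K := by linarith
    _ ≤ (1 + 2 / √c) * k * ((2 + √(3 / c)) * (normL2Time T dg + ‖g0‖)) := by gcongr
    _ = _ := by ring

end Abstract

/-! ### The Dirichlet form on the Sobolev space -/

section Sobolev

variable {n : ℕ} {Ω : Set (Space n)}

theorem integral_norm_mul_norm_le {X E F : Type*} [MeasurableSpace X] {μ : Measure X}
    [NormedAddCommGroup E] [NormedAddCommGroup F] (f : Lp E 2 μ) (h : Lp F 2 μ) :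
    Integrable (fun x => ‖f x‖ * ‖h x‖) μ ∧ ∫ x, ‖f x‖ * ‖h x‖ ∂μ ≤ ‖f‖ * ‖h‖ := by
  have hf := (Lp.memLp f).norm
  have hh := (Lp.memLp h).norm
  refine ⟨hf.integrable_mul hh, ?_⟩
  have h1 : inner ℝ (hf.toLp _) (hh.toLp _) = ∫ x, ‖f x‖ * ‖h x‖ ∂μ := by
    rw [L2.inner_def]
    refine integral_congr_ae ?_
    filter_upwards [hf.coeFn_toLp, hh.coeFn_toLp] with x h2 h3
    rw [h2, h3]
    simp [mul_comm]
  have h2 : ‖hf.toLp _‖ = ‖f‖ := by rw [Lp.norm_toLp, eLpNorm_norm, Lp.norm_def]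
  have h3 : ‖hh.toLp _‖ = ‖h‖ := by rw [Lp.norm_toLp, eLpNorm_norm, Lp.norm_def]
  rw [← h1, ← h2, ← h3]
  exact real_inner_le_norm _ _

theorem L2_norm_sq_eq_integral {X E : Type*} [MeasurableSpace X] {μ : Measure X}
    [NormedAddCommGroup E] [InnerProductSpace ℝ E] (f : Lp E 2 μ) :
    Integrable (fun x => ‖f x‖ ^ 2) μ ∧ ‖f‖ ^ 2 = ∫ x, ‖f x‖ ^ 2 ∂μ := by
  refine ⟨(Lp.memLp f).integrable_norm_pow (by simp), ?_⟩
  rw [← real_inner_self_eq_norm_sq, L2.inner_def]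
  simp

theorem intervalIntegrable_of_memLp_two {E : Type*} [NormedAddCommGroup E] {f : ℝ → E} {T : ℝ}
    (hT : 0 ≤ T) (hf : MemLp f 2 (volume.restrict (Ioo 0 T))) :
    IntervalIntegrable f volume 0 T ∧ IntervalIntegrable (fun t => ‖f t‖ ^ 2) volume 0 T :=
  ⟨(intervalIntegrable_iff_integrableOn_Ioo_of_le hT).2 (hf.integrable (by norm_num)),
    (intervalIntegrable_iff_integrableOn_Ioo_of_le hT).2 (hf.integrable_norm_pow (by simp))⟩

theorem IsTestFunction.eq_zero {φ : Space n → ℝ} (hφ : IsTestFunction Ω φ) {x : Space n}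
    (hx : x ∉ Ω) : φ x = 0 :=
  image_eq_zero_of_notMem_tsupport fun h => hx (hφ.support h)

/-- Integration by parts of `φ² = φ² ∂₁x₁` in the first coordinate direction, with `|x₁| ≤ R` on `Ω`. -/
theorem IsTestFunction.integral_sq_le (hn : 0 < n) {φ : Space n → ℝ} (hφ : IsTestFunction Ω φ)
    (hΩ : MeasurableSet Ω) {R : ℝ} (hR : ∀ x ∈ Ω, ‖x‖ ≤ R) :
    ∫ x in Ω, ‖φ x‖ ^ 2 ≤ ∫ x in Ω, 2 * R * (‖φ x‖ * ‖gradient φ x‖) := by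
  set i : Fin n := ⟨0, hn⟩
  set v : Space n := EuclideanSpace.single i 1 with hv
  let p : Space n →L[ℝ] ℝ := EuclideanSpace.proj i
  have hpv : p v = 1 := by simp [p, hv]
  have hφd : Differentiable ℝ φ := hφ.smooth.differentiable (by simp)
  have hφc : Continuous φ := hφ.smooth.continuous
  have hφ'c : Continuous (fderiv ℝ φ) := hφ.smooth.continuous_fderiv (by simp)
  have hgc : Continuous (gradient φ) := (InnerProductSpace.toDual ℝ _).symm.continuous.comp hφ'c
  have hd : ∀ x, fderiv ℝ (fun y => φ y ^ 2) x v = 2 * φ x * fderiv ℝ φ x v := by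
    intro x
    have := ((hφd x).hasFDerivAt.pow 2).fderiv
    rw [this]
    simp
  have hcs : HasCompactSupport fun x => φ x ^ 2 :=
    hφ.compact.comp_left (g := fun y => y ^ 2) (by simp)
  have hcs2 : HasCompactSupport fun x => 2 * φ x * fderiv ℝ φ x v * p x :=
    ((hφ.compact.mul_left (f := fun _ => (2 : ℝ))).mul_right
      (f' := fun x => fderiv ℝ φ x v)).mul_right
  have hparts := integral_mul_fderiv_eq_neg_fderiv_mul_of_integrable (μ := volume)
    (f := fun x => φ x ^ 2) (g := p) (v := v)
    (by
      simp only [hd]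
      exact Continuous.integrable_of_hasCompactSupport (by fun_prop) hcs2)
    (by
      simp only [ContinuousLinearMap.fderiv, hpv, mul_one]
      exact Continuous.integrable_of_hasCompactSupport (by fun_prop) hcs)
    (Continuous.integrable_of_hasCompactSupport (by fun_prop) hcs.mul_right)
    (fun x _ => (hφd x).pow 2) (fun x _ => p.differentiableAt)
  simp only [ContinuousLinearMap.fderiv, hpv, mul_one, hd] at hparts
  have h1 : ∫ x in Ω, ‖φ x‖ ^ 2 = ∫ x, φ x ^ 2 := by
    simp only [Real.norm_eq_abs, sq_abs]
    exact setIntegral_eq_integral_of_forall_compl_eq_zero fun x hx => by simp [hφ.eq_zero hx]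
  have h2 : ∫ x, 2 * φ x * fderiv ℝ φ x v * p x = ∫ x in Ω, 2 * φ x * fderiv ℝ φ x v * p x :=
    (setIntegral_eq_integral_of_forall_compl_eq_zero fun x hx => by simp [hφ.eq_zero hx]).symm
  rw [h1, hparts, h2, ← integral_neg]
  refine setIntegral_mono_on ?_ ?_ hΩ fun x hx => ?_
  · exact (Continuous.integrable_of_hasCompactSupport (by fun_prop) hcs2).neg.integrableOn
  · have hcs3 : HasCompactSupport fun x => 2 * R * (‖φ x‖ * ‖gradient φ x‖) :=
      hφ.compact.norm.mul_right.mul_left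
    exact (Continuous.integrable_of_hasCompactSupport (by fun_prop) hcs3).integrableOn
  · have h3 : |fderiv ℝ φ x v| ≤ ‖gradient φ x‖ := by
      rw [gradient, LinearIsometryEquiv.norm_map]
      simpa [hv] using (fderiv ℝ φ x).le_opNorm v
    have h4 : |p x| ≤ R := (show |x i| ≤ ‖x‖ by
      simpa only [Real.norm_eq_abs] using PiLp.norm_apply_le x i).trans (hR x hx)
    refine (neg_le_abs _).trans ?_
    rw [abs_mul, abs_mul, abs_mul, abs_two, Real.norm_eq_abs]
    calc 2 * |φ x| * |fderiv ℝ φ x v| * |p x| ≤ 2 * |φ x| * ‖gradient φ x‖ * R := by gcongr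
      _ = _ := by ring

/-- The Poincaré inequality on a bounded set. By density it suffices to consider test functions,
where it follows from `IsTestFunction.integral_sq_le` and the Cauchy–Schwarz inequality. -/
theorem poincare_inequality (hn : 0 < n) (hΩ : IsOpen Ω) {R : ℝ} (hR : ∀ x ∈ Ω, ‖x‖ ≤ R)
    (hR0 : 0 ≤ R) (w : H10 Ω) : ‖fn w‖ ≤ 2 * R * ‖grad w‖ := by
  have hclosed : IsClosed {p : L2Pair Ω | ‖p.fst‖ ≤ 2 * R * ‖p.snd‖} :=
    isClosed_le (WithLp.fstL 2 ℝ (L2 Ω) (L2Vec Ω)).continuous.norm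
      (continuous_const.mul (WithLp.sndL 2 ℝ (L2 Ω) (L2Vec Ω)).continuous.norm)
  refine closure_minimal ?_ hclosed w.2
  rintro p ⟨φ, hφ, h1, h2⟩
  obtain ⟨hi, hle⟩ := integral_norm_mul_norm_le p.fst p.snd
  have h3 := hφ.integral_sq_le hn hΩ.measurableSet hR
  have h4 : ∫ x in Ω, ‖φ x‖ ^ 2 = ‖p.fst‖ ^ 2 := by
    rw [(L2_norm_sq_eq_integral p.fst).2]
    exact integral_congr_ae (h1.mono fun x hx => by simp only [hx])
  have h5 : ∫ x in Ω, 2 * R * (‖φ x‖ * ‖gradient φ x‖) =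
      2 * R * ∫ x in Ω, ‖p.fst x‖ * ‖p.snd x‖ := by
    rw [← integral_const_mul]
    refine integral_congr_ae ?_
    filter_upwards [h1, h2] with x hx1 hx2
    rw [hx1, hx2]
  rw [h4, h5] at h3
  have h6 : ‖p.fst‖ * ‖p.fst‖ ≤ 2 * R * ‖p.snd‖ * ‖p.fst‖ := by
    have : 2 * R * ∫ x in Ω, ‖p.fst x‖ * ‖p.snd x‖ ≤ 2 * R * (‖p.fst‖ * ‖p.snd‖) := by gcongr
    linarith
  rcases (norm_nonneg p.fst).eq_or_lt with h7 | h7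
  · change ‖p.fst‖ ≤ 2 * R * ‖p.snd‖
    rw [← h7]; positivity
  · exact le_of_mul_le_mul_right h6 h7

/-- The embedding `H¹₀(Ω) → L²(Ω)`, that is `fn`, as a continuous linear map. -/
noncomputable def fnL (Ω : Set (Space n)) : H10 Ω →L[ℝ] L2 Ω :=
  (WithLp.fstL 2 ℝ (L2 Ω) (L2Vec Ω)).comp (H10 Ω).subtypeL

theorem norm_sq_eq_fn_add_grad (w : H10 Ω) : ‖w‖ ^ 2 = ‖fn w‖ ^ 2 + ‖grad w‖ ^ 2 :=
  WithLp.prod_norm_sq_eq_of_L2 _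

variable {a : Space n → Matrix (Fin n) (Fin n) ℝ} {lam : ℝ}

theorem IsEllipticMedium.exists_bound (ha : IsEllipticMedium Ω a lam) :
    ∃ A : ℝ, 0 ≤ A ∧ ∀ᵐ x ∂(vol Ω), ∀ ξ η : Space n,
      |∑ i, ∑ j, ξ i * a x i j * η j| ≤ A * (‖ξ‖ * ‖η‖) := by
  have h1 : ∀ i j, ∃ A : ℝ, ∀ᵐ x ∂(vol Ω), |a x i j| ≤ A := fun i j =>
    ⟨_, by simpa using ae_le_lpNorm_exponent_top (ha.bounded i j)⟩
  choose A hA using h1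
  refine ⟨∑ i, ∑ j, |A i j|, by positivity, ?_⟩
  have h2 : ∀ᵐ x ∂(vol Ω), ∀ i j, |a x i j| ≤ A i j := by
    rw [ae_all_iff]; intro i; rw [ae_all_iff]; exact hA i
  filter_upwards [h2] with x hx ξ η
  rw [Finset.sum_mul]
  refine (Finset.abs_sum_le_sum_abs _ _).trans (Finset.sum_le_sum fun i _ => ?_)
  rw [Finset.sum_mul]
  refine (Finset.abs_sum_le_sum_abs _ _).trans (Finset.sum_le_sum fun j _ => ?_)
  have h3 : |ξ i| ≤ ‖ξ‖ := by simpa using PiLp.norm_apply_le ξ i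
  have h4 : |η j| ≤ ‖η‖ := by simpa using PiLp.norm_apply_le η j
  rw [abs_mul, abs_mul]
  calc |ξ i| * |a x i j| * |η j| ≤ ‖ξ‖ * |A i j| * ‖η‖ := by
        have h5 := (hx i j).trans (le_abs_self _)
        gcongr ?_ * ?_ * ?_
    _ = _ := by ring

theorem IsEllipticMedium.integrable (ha : IsEllipticMedium Ω a lam) (G H : L2Vec Ω) :
    Integrable (fun x => ∑ i, ∑ j, G x i * a x i j * H x j) (vol Ω) := by
  obtain ⟨A, -, hA⟩ := ha.exists_bound
  refine ((integral_norm_mul_norm_le G H).1.const_mul A).mono' ?_ (hA.mono fun x hx => hx _ _)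
  have hG : ∀ (G : L2Vec Ω) i, AEStronglyMeasurable (fun x => G x i) (vol Ω) := fun G i =>
    (EuclideanSpace.proj (𝕜 := ℝ) i).continuous.comp_aestronglyMeasurable
      (Lp.aestronglyMeasurable G)
  refine Finset.aestronglyMeasurable_fun_sum _ fun i _ =>
    Finset.aestronglyMeasurable_fun_sum _ fun j _ => ?_
  exact ((hG G i).mul (ha.bounded i j).1).mul (hG H j)

theorem IsEllipticMedium.energyForm_comm (ha : IsEllipticMedium Ω a lam) (G H : L2Vec Ω) :
    energyForm Ω a G H = energyForm Ω a H G := by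
  refine integral_congr_ae ?_
  filter_upwards [ha.symm] with x hx
  rw [Finset.sum_comm]
  refine Finset.sum_congr rfl fun i _ => Finset.sum_congr rfl fun j _ => ?_
  rw [hx.apply]; ring

theorem IsEllipticMedium.energyForm_add_left (ha : IsEllipticMedium Ω a lam)
    (G G' H : L2Vec Ω) :
    energyForm Ω a (G + G' : L2Vec Ω) H = energyForm Ω a G H + energyForm Ω a G' H := by
  unfold energyForm
  rw [← integral_add (ha.integrable G H) (ha.integrable G' H)]
  refine integral_congr_ae ?_
  filter_upwards [Lp.coeFn_add G G'] with x hx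
  simp only [hx, Pi.add_apply, PiLp.add_apply, add_mul, Finset.sum_add_distrib]

theorem energyForm_smul_left (s : ℝ) (G H : L2Vec Ω) :
    energyForm Ω a (s • G : L2Vec Ω) H = s * energyForm Ω a G H := by
  unfold energyForm
  rw [← integral_const_mul]
  refine integral_congr_ae ?_
  filter_upwards [Lp.coeFn_smul s G] with x hx
  simp only [hx, Pi.smul_apply, PiLp.smul_apply, smul_eq_mul, Finset.mul_sum, mul_assoc]

/-- The Dirichlet form as a continuous bilinear form on `H¹₀(Ω)`. Its norm depends on the `L^∞` bound
of `a`, but only its existence is used. -/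
theorem IsEllipticMedium.exists_continuous_form (ha : IsEllipticMedium Ω a lam) :
    ∃ B : H10 Ω →L[ℝ] H10 Ω →L[ℝ] ℝ, ∀ v w, B v w = dirichletForm a v w := by
  obtain ⟨A, hA0, hA⟩ := ha.exists_bound
  let b : H10 Ω →ₗ[ℝ] H10 Ω →ₗ[ℝ] ℝ := LinearMap.mk₂ ℝ (dirichletForm a)
    (fun v v' w => ha.energyForm_add_left _ _ _)
    (fun s v w => energyForm_smul_left s _ _)
    (fun v w w' => by
      unfold dirichletForm
      rw [ha.energyForm_comm, ha.energyForm_comm (grad v) (grad w),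
        ha.energyForm_comm (grad v) (grad w')]
      exact ha.energyForm_add_left _ _ _)
    (fun s v w => by
      unfold dirichletForm
      rw [ha.energyForm_comm, ha.energyForm_comm (grad v) (grad w)]
      exact energyForm_smul_left s _ _)
  refine ⟨b.mkContinuous₂ A fun v w => ?_, fun v w => rfl⟩
  obtain ⟨hi, hle⟩ := integral_norm_mul_norm_le (grad v) (grad w)
  have h1 : ∀ v : H10 Ω, ‖grad v‖ ≤ ‖v‖ := fun v => by
    refine le_of_sq_le_sq ?_ (norm_nonneg _)
    rw [norm_sq_eq_fn_add_grad]
    exact le_add_of_nonneg_left (by positivity)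
  calc ‖b v w‖ ≤ ∫ x in Ω, A * (‖grad v x‖ * ‖grad w x‖) :=
        norm_integral_le_of_norm_le (hi.const_mul A) (hA.mono fun x hx => hx _ _)
    _ = A * ∫ x in Ω, ‖grad v x‖ * ‖grad w x‖ := integral_const_mul _ _
    _ ≤ A * (‖grad v‖ * ‖grad w‖) := by gcongr
    _ ≤ A * (‖v‖ * ‖w‖) := by gcongr <;> exact h1 _
    _ = A * ‖v‖ * ‖w‖ := by ring

theorem IsEllipticMedium.coercive (ha : IsEllipticMedium Ω a lam) (w : H10 Ω) :
    lam * ‖grad w‖ ^ 2 ≤ dirichletForm a w w := by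
  obtain ⟨hi, he⟩ := L2_norm_sq_eq_integral (grad w)
  rw [he, ← integral_const_mul]
  exact integral_mono_ae (hi.const_mul lam) (ha.integrable _ _) (ha.elliptic.mono fun x hx => hx _)

/-- The space `V_h = {φ ∘ F : φ ∈ X_h} ∩ H¹₀(Ω)` as a linear subspace of `H¹₀(Ω)`. -/
def elementSubmodule (Ω : Set (Space n)) (F : Space n → Space n)
    (X : Submodule ℝ (Space n → ℝ)) : Submodule ℝ (H10 Ω) where
  carrier := elementsInCoordinates Ω F X
  zero_mem' := ⟨0, X.zero_mem, Lp.coeFn_zero _ _ _⟩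
  add_mem' := by
    rintro v w ⟨φ, hφ, h1⟩ ⟨ψ, hψ, h2⟩
    exact ⟨φ + ψ, X.add_mem hφ hψ, (Lp.coeFn_add (fn v) (fn w)).trans (h1.add h2)⟩
  smul_mem' := by
    rintro s w ⟨φ, hφ, h1⟩
    exact ⟨s • φ, X.smul_mem s hφ, (Lp.coeFn_smul s (fn w)).trans (h1.const_smul s)⟩

end Sobolev
end ParabolicHomogenization

open ParabolicHomogenization in
theorem theorem1p12 (n : ℕ) (hn : 0 < n) (Ω : Set (Space n)) (hΩ : IsOpen Ω)
    (hΩb : Bornology.IsBounded Ω) (lam : ℝ) (hlam : 0 < lam) :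
    ∃ C : ℝ, ∀ (a : Space n → Matrix (Fin n) (Fin n) ℝ), IsEllipticMedium Ω a lam →
      ∀ F : Space n → Space n, IsHarmonicCoordinates Ω a F →
      ∀ X : Submodule ℝ (Space n → ℝ), IsElementSpace Ω X →
      ∀ (T : ℝ) (M : ℕ), 0 < T → 0 < M →
      ∀ (g : ℝ → L2 Ω) (dg : ℝ → Hneg1 Ω) (g0 : L2 Ω), HasTimeDerivative T g dg g0 →
      ∀ u v : ℝ → H10 Ω,
        IsSemiDiscreteSolution a (elementsInCoordinates Ω F X) T g u →
        IsImplicitSolution a (elementsInCoordinates Ω F X) T M g v →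
        ‖fn (u T - v T)‖ + normL2Time T (fun t => u t - v t) ≤
          C * (T / M) * (normL2Time T dg + ‖g0‖) := by
  obtain ⟨R, hR0, hR⟩ : ∃ R : ℝ, 0 ≤ R ∧ ∀ x ∈ Ω, ‖x‖ ≤ R := by
    obtain ⟨R, hR0, hR⟩ := hΩb.exists_pos_norm_le
    exact ⟨R, hR0.le, hR⟩
  set c := lam / (1 + (2 * R) ^ 2) with hcdef
  have hc : 0 < c := by positivity
  -- `c` is the coercivity constant of the Dirichlet form for the `H¹` norm, which follows
  -- from `‖w‖² ≤ (1 + (2R)²) ‖∇w‖²`.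
  refine ⟨(1 + 2 / √c) * (2 + √(3 / c)), ?_⟩
  intro a ha F _ X _ T M hT hM g dg g0 hg u v ⟨huV, du, hdu, hu, heqn⟩ hv
  obtain ⟨B, hB⟩ := ha.exists_continuous_form
  have hsymm : ∀ x y, B x y = B y x := fun x y => by
    rw [hB, hB]; exact ha.energyForm_comm _ _
  have hcoer : ∀ x, c * ‖x‖ ^ 2 ≤ B x x := by
    intro x
    have h1 := poincare_inequality hn hΩ hR hR0 x
    have h2 : ‖fn x‖ ^ 2 ≤ (2 * R) ^ 2 * ‖grad x‖ ^ 2 := by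
      rw [← mul_pow]; exact pow_le_pow_left₀ (norm_nonneg _) h1 2
    rw [hB]
    refine le_trans ?_ (ha.coercive x)
    rw [hcdef, div_mul_eq_mul_div, div_le_iff₀ (by positivity), norm_sq_eq_fn_add_grad, mul_assoc]
    gcongr
    linarith
  have hev : IsEvolution (fnL Ω) B (elementSubmodule Ω F X) T g u du :=
    ⟨huV, hdu, hu, by
      filter_upwards [(ae_restrict_iff' measurableSet_Ioo).1 heqn] with t ht hm ψ hψ
      rw [hB]; exact ht hm ψ hψ⟩
  have hwd : HasWeakDerivative (fnL Ω) T g dg g0 := by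
    obtain ⟨h1, h2⟩ := intervalIntegrable_of_memLp_two (E := Hneg1 Ω) hT.le hg.memLp_deriv
    refine ⟨h1, h2, ?_⟩
    filter_upwards [(ae_restrict_iff' measurableSet_Ioo).1 hg.eq_integral] with t ht hm ψ
    have h1 := DFunLike.congr_fun (ht hm) ψ
    rw [add_apply] at h1
    rw [real_inner_comm, real_inner_comm g0]
    exact h1
  refine hev.implicit_euler_error_le hwd (fun ψ => ?_) hsymm hc hcoer hT hM hv.mem hv.const
    hv.initial ?_
  · exact intervalIntegrable_clm_comp (innerSL ℝ (fnL Ω ψ))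
      (intervalIntegrable_of_memLp_two hT.le hg.memLp).1
  · intro m hm ψ hψ
    simp only [hB]
    exact hv.step m hm ψ hψ
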